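/- Let $\Phi$ be the Fourier transform on $L^2(\mathbb R)$, $(\Phi u)(t)=\frac1{\sqrt{2\pi}}\int_{\mathbb R}u(x)e^{-ixt}\,dx$, let $H^2_+(\mathbb R)=\{u\in L^2(\mathbb R): (\Phi u)(t)=0 \text{ for a.e. } t<0\}$, and let $\mathbf P_+:L^2(\mathbb R)\to H^2_+(\mathbb R)$ be the orthogonal projection. For $\omega\in L^\infty(\mathbb R)$ the Hankel operator $\mathbf H(\omega)$ on $H^2_+(\mathbb R)$ is defined by $\mathbf H(\omega)f=\mathbf P_+(\omega\,\mathbf W f)$, where $(\mathbf Wf)(x)=f(-x)$. For a compact operator $A$ on a Hilbert space, $s_1(A)\ge s_2(A)\ge\dots$ denote its singular values, that is, the eigenvalues of $|A|=\sqrt{A^*A}$ in non-increasing order, counted with multiplicity and continued by zeros if necessary; for a bounded non-compact $A$, $s_n(A)$ denotes the $n$-th min-max value of $|A|$ (equivalently, the infimum of those $\varepsilon\ge0$ for which $\sigma(|A|)\cap(\varepsilon,\infty)$ is a finite set and the eigenvalues of $|A|$ in $(\varepsilon,\infty)$ have total multiplicity less than $n$). Let $\mathbb R_*=\mathbb R\cup\{\infty\}$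 be the real line with the points $+\infty$ and $-\infty$ identified, regarded as a smooth closed curve (diffeomorphic to the unit circle via $x\mapsto\frac{x-i/2}{x+i/2}$), so that $y=1/x$ is a local coordinate at $\infty$. The singular support $\operatorname{sing\,supp}\omega\subset\mathbb R_*$ of $\omega\in L^\infty(\mathbb R)$ is the smallest closed set $X\subset\mathbb R_*$ such that $\omega\in C^\infty(\mathbb R_*\setminus X)$, i.e. such that $\omega$ agrees a.e. with a function which on $\mathbb R_*\setminus X$ is infinitely differentiable in the coordinate $x$ away from $\infty$ and in the coordinate $y=1/x$ away from $0$. Theorem. Let $\omega_1,\dots,\omega_L\in L^\infty(\mathbb R)$, $L<\infty$, be such that $$\operatorname{sing\,supp}\omega_\ell\cap\operatorname{sing\,supp}\omega_j=\varnothing,\qquad \ell\ne j,$$ and set $\omega=\omega_1+\dots+\omega_L$. Then for all $p>0$ $$\limsup_{n\to\infty} n\,s_n(\mathbf H(\omega))^p\le\sum_{\ell=1}^L\limsup_{n\to\infty} n\,s_n(\mathbf H(\omega_\ell))^p,$$ $$\liminf_{n\to\infty} n\,s_n(\mathbf H(\omega))^p\ge\sum_{\ell=1}^L\liminf_{n\to\infty}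 n\,s_n(\mathbf H(\omega_\ell))^p,$$ where all upper and lower limits are taken in $[0,\infty]$. -/

import Mathlib

open MeasureTheory Filter Set
open scoped ENNReal FourierTransform

noncomputable section

namespace HankelLoc

/-- The complex Hilbert space `L²(ℝ)`. -/
abbrev L2R : Type := Lp ℂ 2 (volume : Measure ℝ)

/-- The space of symbols `L^∞(ℝ)`. -/
abbrev LinftyR : Type := Lp ℂ ∞ (volume : Measure ℝ)

/-- The Hardy space `H²₊(ℝ)`: all `u ∈ L²(ℝ)` whose Fourier transform vanishes a.e. on `(-∞, 0)`.
Mathlib's `𝓕` has the kernel `exp (-2πixt)`; this only rescales the frequency variable by a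
positive factor. -/
def hardy : Submodule ℂ L2R where
  carrier := {u | ∀ᵐ t : ℝ, t < 0 → (𝓕 u : L2R) t = 0}
  zero_mem' := by
    have h : (𝓕 (0 : L2R) : L2R) = 0 := (Lp.fourierTransformₗᵢ ℝ ℂ).map_zero
    simp only [mem_ofPred_eq, h]
    filter_upwards [Lp.coeFn_zero ℂ 2 (volume : Measure ℝ)] with t ht _
    exact ht
  add_mem' := by
    intro u v hu hv
    have h : (𝓕 (u + v) : L2R) = 𝓕 u + 𝓕 v := (Lp.fourierTransformₗᵢ ℝ ℂ).map_add u v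
    simp only [mem_ofPred_eq, h] at hu hv ⊢
    filter_upwards [Lp.coeFn_add (𝓕 u : L2R) (𝓕 v : L2R), hu, hv] with t ht h1 h2 h3
    rw [ht, Pi.add_apply, h1 h3, h2 h3, add_zero]
  smul_mem' := by
    intro c u hu
    have h : (𝓕 (c • u) : L2R) = c • 𝓕 u := (Lp.fourierTransformₗᵢ ℝ ℂ).map_smul c u
    simp only [mem_ofPred_eq, h] at hu ⊢
    filter_upwards [Lp.coeFn_smul c (𝓕 u : L2R), hu] with t ht h1 h3
    rw [ht, Pi.smul_apply, h1 h3, smul_zero]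

theorem isClosed_hardy : IsClosed (hardy : Set L2R) := by
  have h : (hardy : Set L2R) =
      {u | LpToLpRestrictCLM ℝ ℂ ℂ volume 2 (Iio 0) (Lp.fourierTransformₗᵢ ℝ ℂ u) = 0} := by
    ext u
    change (∀ᵐ t : ℝ, t < 0 → (Lp.fourierTransformₗᵢ ℝ ℂ u : L2R) t = 0) ↔ _
    have h1 := LpToLpRestrictCLM_coeFn ℂ (Iio (0 : ℝ)) (Lp.fourierTransformₗᵢ ℝ ℂ u)
    rw [mem_ofPred_eq, Lp.eq_zero_iff_ae_eq_zero]
    refine (ae_restrict_iff' (measurableSet_Iio (a := (0 : ℝ)))).symm.trans ?_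
    constructor
    · intro h2
      filter_upwards [h1, h2] with t h3 h4
      rw [h3, h4]; rfl
    · intro h2
      filter_upwards [h1, h2] with t h3 h4
      rw [← h3, h4]; rfl
  rw [h]
  exact isClosed_eq (by fun_prop) continuous_const

instance : CompleteSpace hardy := isClosed_hardy.completeSpace_coe

/-- The involution `(W f)(x) = f(-x)` of `L²(ℝ)`. -/
def reflection : L2R →L[ℂ] L2R :=
  (Lp.compMeasurePreservingₗᵢ ℂ (fun x : ℝ => -x)
    (Measure.measurePreserving_neg volume)).toContinuousLinearMap

/-- Multiplication by `ω ∈ L^∞(ℝ)` on `L²(ℝ)`. -/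
def mulOp (ω : LinftyR) : L2R →L[ℂ] L2R :=
  (ContinuousLinearMap.mul ℂ ℂ).holderL volume ∞ 2 2 ω

/-- The Hankel operator `f ↦ P₊(ω W f)` on `H²₊(ℝ)`. -/
def hankel (ω : LinftyR) : hardy →L[ℂ] hardy :=
  hardy.orthogonalProjectionOnto ∘L mulOp ω ∘L reflection ∘L hardy.subtypeL

/-- The singular values `s_n(A)`, `n ≥ 1`: the eigenvalues of `|A| = √(A* A)` in non-increasing
order, repeated according to multiplicity (and continued by `0` if there are only finitely many
positive ones). Equivalently, `s_n(A)` is the least `ε ≥ 0` such that the eigenvalues of `|A|` in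
`(ε, ∞)` have total multiplicity less than `n`. For compact `A` the finiteness condition on the
spectrum is automatic; for a bounded non-compact `A` it makes `s_n(A)` the `n`-th min-max value of
`|A|`, so that `s_n(A)` then does not tend to `0`. -/
def singularValue {E : Type*} [NormedAddCommGroup E] [InnerProductSpace ℂ E] [CompleteSpace E]
    (A : E →L[ℂ] E) (n : ℕ) : ℝ :=
  sInf {ε : ℝ | 0 ≤ ε ∧ (spectrum ℝ (CFC.abs A) ∩ Ioi ε).Finite ∧
    Module.rank ℂ (⨆ μ ∈ Ioi ε, Module.End.eigenspace (CFC.abs A).toLinearMap (μ : ℂ) :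
      Submodule ℂ E) < (n : Cardinal)}

/-- The compactified line `ℝ_*`, with `+∞` and `-∞` identified. -/
abbrev RStar : Type := OnePoint ℝ

/-- The local parameter `y = 1/x` of the circle `ℝ_*` at `∞`, as a parametrization
of `ℝ_* ∖ {0}`. -/
def chartInfty (y : ℝ) : RStar := if y = 0 then OnePoint.infty else ((y⁻¹ : ℝ) : RStar)

/-- `ω ∈ C^∞(U)` for an open `U ⊆ ℝ_*`: after a change on a null set, `ω` is on `U` a function that
is smooth in the two coordinates `x` (away from `∞`) and `y = 1/x` (away from `0`). -/
def IsSmoothOn (ω : LinftyR) (U : Set RStar) : Prop :=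
  ∃ f : RStar → ℂ,
    (∀ᵐ x : ℝ, (x : RStar) ∈ U → ω x = f x) ∧
    ContDiffOn ℝ ((⊤ : ℕ∞) : WithTop ℕ∞) (fun x : ℝ => f x) {x : ℝ | (x : RStar) ∈ U} ∧
    ContDiffOn ℝ ((⊤ : ℕ∞) : WithTop ℕ∞) (fun y : ℝ => f (chartInfty y)) {y : ℝ | chartInfty y ∈ U}

/-- The singular support of `ω`: the smallest closed `X ⊆ ℝ_*` with `ω ∈ C^∞(ℝ_* ∖ X)`. -/
def singSupp (ω : LinftyR) : Set RStar :=
  ⋂₀ {X : Set RStar | IsClosed X ∧ IsSmoothOn ω Xᶜ}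

end HankelLoc

end

noncomputable section

namespace HankelLoc

section Approximation

variable {E F G : Type*} [NormedAddCommGroup E] [InnerProductSpace ℂ E]
  [NormedAddCommGroup F] [InnerProductSpace ℂ F] [NormedAddCommGroup G] [InnerProductSpace ℂ G]

/-- `A` is bounded by `ε` on the orthogonal complement of a subspace of dimension less than `n`. -/
def ApproxBound (A : E →L[ℂ] F) (n : ℕ) (ε : ℝ) : Prop :=
  ∃ V : Submodule ℂ E, Module.rank ℂ V < n ∧ ∀ x ∈ Vᗮ, ‖A x‖ ≤ ε * ‖x‖

theorem finiteDimensional_of_rank_lt {V : Submodule ℂ E} {n : ℕ}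
    (h : Module.rank ℂ V < (n : Cardinal)) : FiniteDimensional ℂ V :=
  Module.rank_lt_aleph0_iff.1 (h.trans Cardinal.natCast_lt_aleph0)

theorem rank_le_of_disjoint_orthogonal {V W : Submodule ℂ E} [FiniteDimensional ℂ V]
    (h : Disjoint W Vᗮ) : Module.rank ℂ W ≤ Module.rank ℂ V := by
  let f : W →ₗ[ℂ] V := V.orthogonalProjectionOnto.toLinearMap ∘ₗ W.subtype
  refine LinearMap.rank_le_of_injective f ?_
  rw [← LinearMap.ker_eq_bot, LinearMap.ker_eq_bot']
  intro x hx
  have h1 : (x : E) ∈ Vᗮ := by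
    rw [← V.orthogonalProjectionOnto_eq_zero_iff]
    exact hx
  exact Subtype.ext (Submodule.disjoint_def.1 h _ x.2 h1)

theorem ApproxBound.mono {A : E →L[ℂ] F} {n m : ℕ} {ε δ : ℝ} (h : ApproxBound A n ε)
    (hnm : n ≤ m) (hεδ : ε ≤ δ) : ApproxBound A m δ := by
  obtain ⟨V, hV, hA⟩ := h
  exact ⟨V, hV.trans_le (by exact_mod_cast hnm),
    fun x hx => (hA x hx).trans (by gcongr)⟩

theorem approxBound_norm (A : E →L[ℂ] F) {n : ℕ} (hn : 1 ≤ n) : ApproxBound A n ‖A‖ :=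
  ⟨⊥, by simpa using Nat.pos_of_ne_zero (by omega), fun x _ => A.le_opNorm x⟩

theorem ApproxBound.add {A B : E →L[ℂ] F} {n m : ℕ} {ε δ : ℝ} (hA : ApproxBound A n ε)
    (hB : ApproxBound B m δ) : ApproxBound (A + B) (n + m) (ε + δ) := by
  obtain ⟨V, hV, hA⟩ := hA
  obtain ⟨W, hW, hB⟩ := hB
  refine ⟨V ⊔ W, ?_, fun x hx => ?_⟩
  · refine (Submodule.rank_add_le_rank_add_rank V W).trans_lt ?_
    push_cast
    exact Cardinal.add_lt_add hV hW
  · rw [← Submodule.inf_orthogonal] at hx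
    calc ‖(A + B) x‖ ≤ ‖A x‖ + ‖B x‖ := norm_add_le _ _
      _ ≤ ε * ‖x‖ + δ * ‖x‖ := add_le_add (hA x hx.1) (hB x hx.2)
      _ = _ := by ring

theorem ApproxBound.comp_left {A : E →L[ℂ] F} {n : ℕ} {ε : ℝ} (h : ApproxBound A n ε)
    (B : F →L[ℂ] G) : ApproxBound (B ∘L A) n (‖B‖ * ε) := by
  obtain ⟨V, hV, hA⟩ := h
  refine ⟨V, hV, fun x hx => ?_⟩
  calc ‖B (A x)‖ ≤ ‖B‖ * ‖A x‖ := B.le_opNorm _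
    _ ≤ ‖B‖ * (ε * ‖x‖) := by gcongr; exact hA x hx
    _ = _ := by ring

theorem ApproxBound.comp_right [CompleteSpace E] [CompleteSpace F] {A : F →L[ℂ] G} {n : ℕ}
    {ε : ℝ} (hε : 0 ≤ ε) (h : ApproxBound A n ε) (B : E →L[ℂ] F) :
    ApproxBound (A ∘L B) n (ε * ‖B‖) := by
  obtain ⟨V, hV, hA⟩ := h
  refine ⟨V.map B.adjoint.toLinearMap, ?_, fun x hx => ?_⟩
  · simpa using (lift_rank_map_le B.adjoint.toLinearMap V).trans_lt (Cardinal.lift_lt.2 hV)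
  · have h1 : B x ∈ Vᗮ := by
      intro v hv
      rw [← ContinuousLinearMap.adjoint_inner_left]
      exact hx _ ⟨v, hv, rfl⟩
    calc ‖A (B x)‖ ≤ ε * ‖B x‖ := hA _ h1
      _ ≤ ε * (‖B‖ * ‖x‖) := by gcongr; exact B.le_opNorm _
      _ = _ := by ring

theorem ApproxBound.adjoint [CompleteSpace E] [CompleteSpace F] {A : E →L[ℂ] F} {n : ℕ} {ε : ℝ}
    (hε : 0 ≤ ε) (h : ApproxBound A n ε) : ApproxBound A.adjoint n ε := by
  obtain ⟨V, hV, hA⟩ := h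
  refine ⟨V.map A.toLinearMap, ?_, fun x hx => ?_⟩
  · simpa using (lift_rank_map_le A.toLinearMap V).trans_lt (Cardinal.lift_lt.2 hV)
  · have h1 : A.adjoint x ∈ Vᗮ := by
      intro v hv
      rw [ContinuousLinearMap.adjoint_inner_right]
      exact hx _ ⟨v, hv, rfl⟩
    rcases eq_or_ne (‖A.adjoint x‖) 0 with h0 | h0
    · rw [h0]; positivity
    have h2 : ‖A.adjoint x‖ * ‖A.adjoint x‖ ≤ ‖A.adjoint x‖ * (ε * ‖x‖) := by
      calc ‖A.adjoint x‖ * ‖A.adjoint x‖ = ‖inner ℂ (A.adjoint x) (A.adjoint x)‖ := by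
            rw [inner_self_eq_norm_sq_to_K]; simp [sq]
        _ = ‖inner ℂ x (A (A.adjoint x))‖ := by rw [ContinuousLinearMap.adjoint_inner_left]
        _ ≤ ‖x‖ * ‖A (A.adjoint x)‖ := norm_inner_le_norm _ _
        _ ≤ ‖x‖ * (ε * ‖A.adjoint x‖) := by gcongr; exact hA _ h1
        _ = _ := by ring
    exact le_of_mul_le_mul_left h2 (lt_of_le_of_ne (norm_nonneg _) (Ne.symm h0))

/-- The `n`-th approximation number, in min-max form. -/
def approxNumber (A : E →L[ℂ] F) (n : ℕ) : ℝ := sInf {ε : ℝ | 0 ≤ ε ∧ ApproxBound A n ε}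

theorem bddBelow_approxBound (A : E →L[ℂ] F) (n : ℕ) :
    BddBelow {ε : ℝ | 0 ≤ ε ∧ ApproxBound A n ε} := ⟨0, fun _ h => h.1⟩

theorem approxNumber_nonneg (A : E →L[ℂ] F) (n : ℕ) : 0 ≤ approxNumber A n :=
  Real.sInf_nonneg fun _ h => h.1

theorem approxNumber_le {A : E →L[ℂ] F} {n : ℕ} {ε : ℝ} (hε : 0 ≤ ε) (h : ApproxBound A n ε) :
    approxNumber A n ≤ ε := csInf_le (bddBelow_approxBound A n) ⟨hε, h⟩

theorem approxBound_of_lt {A : E →L[ℂ] F} {n : ℕ} (hn : 1 ≤ n) {ε : ℝ}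
    (h : approxNumber A n < ε) : ApproxBound A n ε := by
  obtain ⟨δ, hδ, hlt⟩ := exists_lt_of_csInf_lt
    (s := {ε : ℝ | 0 ≤ ε ∧ ApproxBound A n ε}) ⟨‖A‖, norm_nonneg _, approxBound_norm A hn⟩ h
  exact hδ.2.mono le_rfl hlt.le

theorem approxNumber_antitone (A : E →L[ℂ] F) {n m : ℕ} (hn : 1 ≤ n) (h : n ≤ m) :
    approxNumber A m ≤ approxNumber A n :=
  le_of_forall_gt_imp_ge_of_dense fun _ hε => approxNumber_le
    ((approxNumber_nonneg _ _).trans hε.le) ((approxBound_of_lt hn hε).mono h le_rfl)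

theorem approxNumber_add_le (A B : E →L[ℂ] F) {n m : ℕ} (hn : 1 ≤ n) (hm : 1 ≤ m) :
    approxNumber (A + B) (n + m) ≤ approxNumber A n + approxNumber B m := by
  refine le_of_forall_pos_le_add fun ε hε => ?_
  have hA := approxBound_of_lt hn (show approxNumber A n < approxNumber A n + ε / 2 by linarith)
  have hB := approxBound_of_lt hm (show approxNumber B m < approxNumber B m + ε / 2 by linarith)
  refine (approxNumber_le ?_ (hA.add hB)).trans (by linarith)
  have := approxNumber_nonneg A n
  have := approxNumber_nonneg B m
  linarith

theorem approxNumber_adjoint [CompleteSpace E] [CompleteSpace F] (A : E →L[ℂ] F) (n : ℕ) :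
    approxNumber A.adjoint n = approxNumber A n := by
  unfold approxNumber
  congr 1
  ext ε
  refine and_congr_right fun hε => ⟨fun h => ?_, fun h => h.adjoint hε⟩
  simpa using h.adjoint hε

theorem finite_spectrum_of_finiteDimensional_range (X : E →L[ℂ] E)
    [FiniteDimensional ℂ X.range] : (spectrum ℝ X).Finite := by
  let f : Module.End ℂ X.range := X.toLinearMap.restrict fun z _ => ⟨z, rfl⟩
  have h1 : ∀ (p : Polynomial ℂ) (z : X.range),
      (Polynomial.aeval X p) (z : E) = ((Polynomial.aeval f p) z : E) := by
    intro p
    induction p using Polynomial.induction_on with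
    | C a => intro z; simp [Algebra.algebraMap_eq_smul_one]
    | add p q hp hq => intro z; simp [hp, hq]
    | monomial n a ih =>
      intro z
      have h2 := ih (f z)
      have h3 : ((f z : X.range) : E) = X z := rfl
      simp only [pow_succ, ← mul_assoc] at h2 ⊢
      rw [map_mul _ _ Polynomial.X, map_mul _ _ Polynomial.X, Polynomial.aeval_X,
        Polynomial.aeval_X]
      change (Polynomial.aeval X (Polynomial.C a * Polynomial.X ^ n)) (X z) = _
      rw [← h3, h2]
      rfl
  have h2 : Polynomial.aeval X (f.charpoly * Polynomial.X) = 0 := by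
    ext y
    rw [map_mul, Polynomial.aeval_X]
    change (Polynomial.aeval X f.charpoly) (X y) = 0
    rw [h1 f.charpoly ⟨X y, y, rfl⟩, f.aeval_self_charpoly]
    rfl
  have hne : f.charpoly * Polynomial.X ≠ 0 :=
    mul_ne_zero f.charpoly_monic.ne_zero Polynomial.X_ne_zero
  have h3 : spectrum ℂ X ⊆ (f.charpoly * Polynomial.X).rootSet ℂ := by
    intro z hz
    have h4 := spectrum.subset_polynomial_aeval X (f.charpoly * Polynomial.X) ⟨z, hz, rfl⟩
    rw [h2] at h4
    have h5 : Nontrivial (E →L[ℂ] E) := by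
      by_contra h
      rw [not_nontrivial_iff_subsingleton] at h
      simp at hz
    rw [spectrum.zero_eq, mem_singleton_iff] at h4
    exact (Polynomial.mem_rootSet_of_ne hne).2 (by simpa using h4)
  rw [← spectrum.preimage_algebraMap (R := ℝ) ℂ]
  exact ((Polynomial.rootSet_finite _ ℂ).subset h3).preimage
    (FaithfulSMul.algebraMap_injective ℝ ℂ).injOn

end Approximation

section Spectral

variable {E F : Type*} [NormedAddCommGroup E] [InnerProductSpace ℂ E] [CompleteSpace E]
  [NormedAddCommGroup F] [InnerProductSpace ℂ F] [CompleteSpace F]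

/-- The positive part of `T - ε`. -/
def excess (T : E →L[ℂ] E) (ε : ℝ) : E →L[ℂ] E := cfc (fun t : ℝ => max (t - ε) 0) T

theorem excess_isSelfAdjoint (T : E →L[ℂ] E) (ε : ℝ) : IsSelfAdjoint (excess T ε) :=
  cfc_predicate _ _

theorem norm_sq_apply_eq {A : E →L[ℂ] F} {T : E →L[ℂ] E} (hT : IsSelfAdjoint T)
    (h : T * T = A.adjoint ∘L A) (x : E) : ‖A x‖ = ‖T x‖ := by
  have h1 : inner ℂ (A x) (A x) = inner ℂ (T x) (T x) := by
    rw [← ContinuousLinearMap.adjoint_inner_left, ← ContinuousLinearMap.comp_apply, ← h,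
      ← ContinuousLinearMap.adjoint_inner_left T,
      ← ContinuousLinearMap.star_eq_adjoint, hT.star_eq]; rfl
  rw [inner_self_eq_norm_sq_to_K, inner_self_eq_norm_sq_to_K] at h1
  have h2 : ‖A x‖ ^ 2 = ‖T x‖ ^ 2 := by exact_mod_cast h1
  exact (sq_eq_sq₀ (norm_nonneg _) (norm_nonneg _)).1 h2

theorem inner_apply_self_adjoint {T : E →L[ℂ] E} (hT : IsSelfAdjoint T) (x y : E) :
    inner ℂ (T x) y = inner ℂ x (T y) := by
  rw [← ContinuousLinearMap.adjoint_inner_right, ← ContinuousLinearMap.star_eq_adjoint, hT.star_eq]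

theorem sub_mul_excess_sq_ge {T : E →L[ℂ] E} (hT : 0 ≤ T) {ε : ℝ} (hε : 0 ≤ ε) :
    excess T ε * excess T ε * (excess T ε * excess T ε) ≤
      excess T ε * (T * T) * excess T ε - (ε ^ 2 : ℝ) • (excess T ε * excess T ε) := by
  have hsa : IsSelfAdjoint T := IsSelfAdjoint.of_nonneg hT
  have hmul : ∀ f g : ℝ → ℝ, Continuous f → Continuous g →
      cfc f T * cfc g T = cfc (fun t => f t * g t) T := fun f g hf hg =>
    (cfc_mul f g T hf.continuousOn hg.continuousOn).symm
  have hTT : T * T = cfc (fun t : ℝ => t * t) T := by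
    rw [← hmul _ _ continuous_id' continuous_id', cfc_id' ℝ T]
  unfold excess
  rw [hTT, hmul _ _ (by fun_prop) (by fun_prop), hmul _ _ (by fun_prop) (by fun_prop),
    hmul _ _ (by fun_prop) (by fun_prop), hmul _ _ (by fun_prop) (by fun_prop),
    ← cfc_smul (ε ^ 2 : ℝ) _ T (by fun_prop),
    ← cfc_sub (fun t : ℝ => max (t - ε) 0 * (t * t) * max (t - ε) 0) _ T
      (by fun_prop) (by fun_prop)]
  refine cfc_mono (fun t ht => ?_) (by fun_prop) (by fun_prop)
  have ht0 : 0 ≤ t := spectrum_nonneg_of_nonneg hT ht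
  rcases le_total t ε with h | h
  · simp [max_eq_right (sub_nonpos.2 h)]
  · rw [max_eq_left (sub_nonneg.2 h)]
    simp only [smul_eq_mul]
    have : 0 ≤ (t - ε) ^ 3 * ε := mul_nonneg (pow_nonneg (sub_nonneg.2 h) 3) hε
    nlinarith

theorem eq_zero_of_mem_range_excess {T : E →L[ℂ] E} (hT : 0 ≤ T) {ε : ℝ} (hε : 0 ≤ ε) {x : E}
    (hx : x ∈ (excess T ε).range) (h : ‖T x‖ ≤ ε * ‖x‖) : x = 0 := by
  obtain ⟨y, rfl⟩ := hx
  set X := excess T ε with hX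
  have hXs : IsSelfAdjoint X := excess_isSelfAdjoint T ε
  have hsa : IsSelfAdjoint T := IsSelfAdjoint.of_nonneg hT
  have h1 := (ContinuousLinearMap.le_def _ _).1 (sub_mul_excess_sq_ge hT hε)
  have h2 := h1.re_inner_nonneg_left y
  have e1 : inner ℂ ((X * (T * T) * X) y) y = inner ℂ (T (X y)) (T (X y)) := by
    simp [inner_apply_self_adjoint hXs, inner_apply_self_adjoint hsa]
  have e2 : inner ℂ ((X * X) y) y = inner ℂ (X y) (X y) := by
    simp [inner_apply_self_adjoint hXs]
  have e3 : inner ℂ ((X * X * (X * X)) y) y = inner ℂ (X (X y)) (X (X y)) := by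
    simp [inner_apply_self_adjoint hXs]
  have e4 : ((ε ^ 2 : ℝ) • (X * X)) y = ((ε ^ 2 : ℝ) : ℂ) • (X * X) y := by
    rw [smul_apply, Complex.coe_smul]
  rw [← hX] at h2
  have h3 : 0 ≤ ‖T (X y)‖ ^ 2 - ε ^ 2 * ‖X y‖ ^ 2 - ‖X (X y)‖ ^ 2 := by
    rw [sub_apply, sub_apply, inner_sub_left, inner_sub_left, e1, e3, e4, inner_smul_left, e2,
      map_sub, map_sub, Complex.conj_ofReal] at h2
    rw [inner_self_eq_norm_sq, inner_self_eq_norm_sq] at h2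
    have e5 : RCLike.re (((ε ^ 2 : ℝ) : ℂ) * inner ℂ (X y) (X y)) = ε ^ 2 * ‖X y‖ ^ 2 := by
      rw [← inner_self_eq_norm_sq (𝕜 := ℂ) (X y)]
      exact Complex.re_ofReal_mul _ _
    rwa [e5] at h2
  have h4 : ‖T (X y)‖ ^ 2 ≤ (ε * ‖X y‖) ^ 2 := by gcongr; exact h
  have h5 : X (X y) = 0 := by
    have : ‖X (X y)‖ ^ 2 ≤ 0 := by nlinarith
    exact norm_eq_zero.1 (pow_eq_zero_iff two_ne_zero |>.1 (le_antisymm this (sq_nonneg _)))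
  have h6 : inner ℂ (X y) (X y) = 0 := by
    rw [← e2]; simp [h5]
  exact inner_self_eq_zero.1 h6

theorem rank_range_excess_lt {A : E →L[ℂ] F} {T : E →L[ℂ] E} (hT : 0 ≤ T)
    (hTA : T * T = A.adjoint ∘L A) {ε : ℝ} (hε : 0 ≤ ε) {n : ℕ} (h : ApproxBound A n ε) :
    Module.rank ℂ (excess T ε).range < n := by
  obtain ⟨V, hV, hA⟩ := h
  have := finiteDimensional_of_rank_lt hV
  refine (rank_le_of_disjoint_orthogonal ?_).trans_lt hV
  rw [Submodule.disjoint_def]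
  intro x hx hx'
  refine eq_zero_of_mem_range_excess hT hε hx ?_
  rw [← norm_sq_apply_eq (IsSelfAdjoint.of_nonneg hT) hTA]
  exact hA x hx'

theorem norm_apply_le_of_excess_apply_eq_zero {T : E →L[ℂ] E} (hT : 0 ≤ T) {ε : ℝ} (hε : 0 ≤ ε)
    {x : E} (hx : excess T ε x = 0) : ‖T x‖ ≤ ε * ‖x‖ ∧ ‖T (T x)‖ ≤ ε ^ 2 * ‖x‖ := by
  have hsa : IsSelfAdjoint T := IsSelfAdjoint.of_nonneg hT
  have hTid : cfc (fun t : ℝ => t) T = T := cfc_id' ℝ T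
  set m : E →L[ℂ] E := cfc (fun t : ℝ => min t ε) T with hm
  have h1 : T = m + excess T ε := by
    rw [hm, excess, ← cfc_add T (fun t : ℝ => min t ε) (fun t : ℝ => max (t - ε) 0) (by fun_prop) (by fun_prop)]
    conv_lhs => rw [← hTid]
    congr 1
    ext t
    rcases le_total t ε with h | h
    · simp [h]
    · simp [h]
  have hcomm : excess T ε * m = m * excess T ε := cfc_commute_cfc _ _ T
  have hnorm : ‖m‖ ≤ ε := by
    refine norm_cfc_le hε fun t ht => ?_
    have ht0 : 0 ≤ t := spectrum_nonneg_of_nonneg hT ht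
    rw [Real.norm_of_nonneg (le_min ht0 hε)]
    exact min_le_right _ _
  have h2 : T x = m x := by
    conv_lhs => rw [h1]
    simp [hx]
  have h3 : excess T ε (m x) = 0 := by
    change (excess T ε * m) x = 0
    rw [hcomm]; simp [hx]
  have h4 : T (m x) = m (m x) := by
    conv_lhs => rw [h1]
    simp [h3]
  have hle : ∀ z, ‖m z‖ ≤ ε * ‖z‖ := fun z => (m.le_opNorm z).trans (by gcongr)
  rw [h2, h4]
  refine ⟨hle x, (hle _).trans ?_⟩
  calc ε * ‖m x‖ ≤ ε * (ε * ‖x‖) := by gcongr; exact hle x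
    _ = _ := by ring

theorem excess_apply_eq_zero_of_mem_orthogonal {T : E →L[ℂ] E} {ε : ℝ} {x : E}
    (hx : x ∈ (excess T ε).rangeᗮ) : excess T ε x = 0 := by
  have h1 := hx (excess T ε (excess T ε x)) ⟨_, rfl⟩
  rw [inner_apply_self_adjoint (excess_isSelfAdjoint T ε)] at h1
  exact inner_self_eq_zero.1 h1

theorem exists_sqrt_adjoint_comp (A : E →L[ℂ] F) :
    ∃ T : E →L[ℂ] E, 0 ≤ T ∧ T * T = A.adjoint ∘L A :=
  ⟨CFC.sqrt (A.adjoint ∘L A), CFC.sqrt_nonneg _, CFC.sqrt_mul_sqrt_self _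
    ((ContinuousLinearMap.nonneg_iff_isPositive _).2
      (ContinuousLinearMap.isPositive_adjoint_comp_self A))⟩

theorem approxBound_iff_rank_range_excess {A : E →L[ℂ] F} {T : E →L[ℂ] E} (hT : 0 ≤ T)
    (hTA : T * T = A.adjoint ∘L A) {ε : ℝ} (hε : 0 ≤ ε) {n : ℕ} :
    ApproxBound A n ε ↔ Module.rank ℂ (excess T ε).range < n := by
  refine ⟨rank_range_excess_lt hT hTA hε, fun h => ⟨_, h, fun x hx => ?_⟩⟩
  rw [norm_sq_apply_eq (IsSelfAdjoint.of_nonneg hT) hTA]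
  exact (norm_apply_le_of_excess_apply_eq_zero hT hε
    (excess_apply_eq_zero_of_mem_orthogonal hx)).1

theorem ApproxBound.adjoint_comp_self {A : E →L[ℂ] F} {ε : ℝ} (hε : 0 ≤ ε) {n : ℕ}
    (h : ApproxBound A n ε) : ApproxBound (A.adjoint ∘L A) n (ε ^ 2) := by
  obtain ⟨T, hT, hTA⟩ := exists_sqrt_adjoint_comp A
  refine ⟨_, rank_range_excess_lt hT hTA hε h, fun x hx => ?_⟩
  rw [← hTA]
  exact (norm_apply_le_of_excess_apply_eq_zero hT hε
    (excess_apply_eq_zero_of_mem_orthogonal hx)).2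

theorem approxBound_of_adjoint_comp_self {A : E →L[ℂ] F} {ε : ℝ} (hε : 0 ≤ ε) {n : ℕ}
    (h : ApproxBound (A.adjoint ∘L A) n (ε ^ 2)) : ApproxBound A n ε := by
  obtain ⟨V, hV, hA⟩ := h
  refine ⟨V, hV, fun x hx => ?_⟩
  have h1 : ‖A x‖ ^ 2 ≤ (ε * ‖x‖) ^ 2 := by
    calc ‖A x‖ ^ 2 = ‖inner ℂ (A x) (A x)‖ := by
          rw [inner_self_eq_norm_sq_to_K]; simp
      _ = ‖inner ℂ ((A.adjoint ∘L A) x) x‖ := by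
          rw [ContinuousLinearMap.comp_apply, ContinuousLinearMap.adjoint_inner_left]
      _ ≤ ‖(A.adjoint ∘L A) x‖ * ‖x‖ := norm_inner_le_norm _ _
      _ ≤ ε ^ 2 * ‖x‖ * ‖x‖ := by gcongr; exact hA x hx
      _ = _ := by ring
  exact le_of_sq_le_sq h1 (by positivity)

theorem approxNumber_adjoint_comp_self (A : E →L[ℂ] F) {n : ℕ} (hn : 1 ≤ n) :
    approxNumber (A.adjoint ∘L A) n = approxNumber A n ^ 2 := by
  have hA := approxNumber_nonneg A n
  have hAA := approxNumber_nonneg (A.adjoint ∘L A) n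
  apply le_antisymm
  · suffices h : √(approxNumber (A.adjoint ∘L A) n) ≤ approxNumber A n from
      (Real.sqrt_le_left hA).1 h
    refine le_of_forall_gt_imp_ge_of_dense fun ε hε => ?_
    have hε0 : 0 ≤ ε := hA.trans hε.le
    exact (Real.sqrt_le_left hε0).2
      (approxNumber_le (by positivity) ((approxBound_of_lt hn hε).adjoint_comp_self hε0))
  · suffices h : approxNumber A n ≤ √(approxNumber (A.adjoint ∘L A) n) from
      (Real.le_sqrt hA hAA).1 h
    refine le_of_forall_gt_imp_ge_of_dense fun ε hε => ?_
    have hε0 : 0 ≤ ε := (Real.sqrt_nonneg _).trans hε.le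
    exact approxNumber_le hε0 (approxBound_of_adjoint_comp_self hε0
      (approxBound_of_lt hn ((Real.sqrt_lt' ((Real.sqrt_nonneg _).trans_lt hε)).1 hε)))

/-- If the approximation number is large, `A` is large on a subspace of dimension `n`. -/
theorem exists_submodule_of_not_approxBound {A : E →L[ℂ] F} {ε : ℝ} (hε : 0 ≤ ε) {n : ℕ}
    (h : ¬ ApproxBound A n ε) : ∃ U : Submodule ℂ E, Module.rank ℂ U = n ∧
      ∀ x ∈ U, ‖A x‖ ≤ ε * ‖x‖ → x = 0 := by
  obtain ⟨T, hT, hTA⟩ := exists_sqrt_adjoint_comp A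
  rw [approxBound_iff_rank_range_excess hT hTA hε, not_lt] at h
  obtain ⟨v, hv⟩ := Module.le_rank_iff.1 h
  refine ⟨Submodule.span ℂ (range fun i => (v i : E)), ?_, fun x hx hle => ?_⟩
  · have hv' : LinearIndependent ℂ (fun i => (v i : E)) :=
      hv.map' (Submodule.subtype _) (Submodule.ker_subtype _)
    rw [rank_span hv']
    simpa using Cardinal.mk_range_eq_of_injective hv'.injective
  · rw [norm_sq_apply_eq (IsSelfAdjoint.of_nonneg hT) hTA] at hle
    refine eq_zero_of_mem_range_excess hT hε ?_ hle
    refine Submodule.span_le.2 ?_ hx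
    rintro _ ⟨i, rfl⟩
    exact (v i).2

/-- The eigenvectors of `T` for eigenvalues above `ε` lie in the range of `(T - ε)₊`. -/
theorem iSup_eigenspace_le_range_excess {T : E →L[ℂ] E} (hT : 0 ≤ T) (ε : ℝ) :
    (⨆ μ ∈ Ioi ε, Module.End.eigenspace T.toLinearMap (μ : ℂ) : Submodule ℂ E) ≤
      (excess T ε).range := by
  have hsa : IsSelfAdjoint T := IsSelfAdjoint.of_nonneg hT
  refine iSup₂_le fun μ hμ x hx => ?_
  have hμ' : 0 < μ - ε := sub_pos.2 hμ
  have hx' : T x = (μ : ℂ) • x := Module.End.mem_eigenspace_iff.1 hx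
  have hpos : ∀ t : ℝ, min t ε - μ ≠ 0 := fun t => by
    have := min_le_right t ε
    linarith
  have hcont : Continuous fun t : ℝ => (min t ε - μ)⁻¹ :=
    (by fun_prop : Continuous fun t : ℝ => min t ε - μ).inv₀ hpos
  have key : cfc (fun t : ℝ => (min t ε - μ)⁻¹) T * (T - algebraMap ℝ _ μ) +
      (μ - ε)⁻¹ • excess T ε = 1 := by
    have h1 : T - algebraMap ℝ _ μ = cfc (fun t : ℝ => t - μ) T := by
      rw [cfc_sub (fun t : ℝ => t) (fun _ => μ) T, cfc_id' ℝ T, cfc_const μ T]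
    rw [h1, excess, ← cfc_mul _ _ T hcont.continuousOn (by fun_prop),
      ← cfc_smul (μ - ε)⁻¹ (fun t : ℝ => max (t - ε) 0) T (by fun_prop),
      ← cfc_add T (fun t : ℝ => (min t ε - μ)⁻¹ * (t - μ)) _
        (hcont.mul (by fun_prop)).continuousOn (by fun_prop), ← cfc_one ℝ T]
    congr 1
    ext t
    have := hpos t
    rcases le_total t ε with h | h
    · rw [min_eq_left h] at this ⊢
      simp [h, this]
    · have h2 : ε - μ ≠ 0 := by linarith
      simp only [min_eq_right h, max_eq_left (sub_nonneg.2 h), smul_eq_mul, Pi.one_apply]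
      field_simp
      ring
  have h2 := congrArg (fun S : E →L[ℂ] E => S x) key
  have h3 : (T - algebraMap ℝ (E →L[ℂ] E) μ) x = 0 := by
    rw [sub_apply, hx', Algebra.algebraMap_eq_smul_one, smul_apply, Complex.coe_smul]
    exact sub_self _
  have h4 : (μ - ε)⁻¹ • excess T ε x = x := by
    simpa [add_apply, mul_apply, h3] using h2
  refine ⟨(((μ - ε)⁻¹ : ℝ) : ℂ) • x, ?_⟩
  rw [← Complex.coe_smul] at h4
  rw [map_smul]
  exact h4

/-- If `T` has only finitely many spectral points above `ε`, the range of `(T - ε)₊` is spanned by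
eigenvectors. -/
theorem range_excess_le_iSup_eigenspace {T : E →L[ℂ] E} (hT : 0 ≤ T) {ε : ℝ}
    (hfin : (spectrum ℝ T ∩ Ioi ε).Finite) : (excess T ε).range ≤
      (⨆ μ ∈ Ioi ε, Module.End.eigenspace T.toLinearMap (μ : ℂ) : Submodule ℂ E) := by
  have hsa : IsSelfAdjoint T := IsSelfAdjoint.of_nonneg hT
  let f : ℝ → ℝ → ℝ := fun μ t => if t = μ then max (t - ε) 0 else 0
  have hcont : ∀ μ ∈ Ioi ε, ContinuousOn (f μ) (spectrum ℝ T) := by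
    intro μ hμ t ht
    rcases le_or_gt t ε with h | h
    · refine (continuousAt_const.congr (f := fun _ => (0 : ℝ)) ?_).continuousWithinAt
      filter_upwards [Iio_mem_nhds (h.trans_lt hμ)] with s hs
      simp [f, (mem_Iio.1 hs).ne]
    · refine (continuousWithinAt_const (b := f μ t)).congr_of_eventuallyEq ?_ rfl
      have h1 : ((spectrum ℝ T ∩ Ioi ε) \ {t})ᶜ ∈ nhds t :=
        (hfin.subset sdiff_subset).isClosed.isOpen_compl.mem_nhds (by simp)
      filter_upwards [nhdsWithin_le_nhds h1, nhdsWithin_le_nhds (Ioi_mem_nhds h),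
        self_mem_nhdsWithin] with s hs1 hs2 hs3
      have : s = t := by
        by_contra hne
        exact hs1 ⟨⟨hs3, hs2⟩, hne⟩
      rw [this]
  have hsum : excess T ε = ∑ μ ∈ hfin.toFinset, cfc (f μ) T := by
    rw [← cfc_sum f T hfin.toFinset (fun μ hμ => hcont μ ((hfin.mem_toFinset.1 hμ).2))]
    refine cfc_congr fun t ht => ?_
    rw [Finset.sum_apply]
    rcases le_or_gt t ε with h | h
    · rw [Finset.sum_eq_zero]
      · simp [h]
      · intro μ _
        simp [f, h]
    · rw [Finset.sum_eq_single t]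
      · simp [f]
      · intro μ _ hne
        simp [f, hne.symm]
      · intro hn
        exact absurd (hfin.mem_toFinset.2 ⟨ht, h⟩) hn
  rintro _ ⟨y, rfl⟩
  rw [hsum]
  change (∑ μ ∈ hfin.toFinset, cfc (f μ) T) y ∈ _
  rw [sum_apply]
  refine Submodule.sum_mem _ fun μ hμ => ?_
  have hμ' := (hfin.mem_toFinset.1 hμ).2
  refine Submodule.mem_iSup_of_mem μ (Submodule.mem_iSup_of_mem hμ' ?_)
  rw [Module.End.mem_eigenspace_iff]
  have h1 : T * cfc (f μ) T = μ • cfc (f μ) T := by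
    rw [← cfc_smul μ (f μ) T (hcont μ hμ')]
    nth_rw 1 [← cfc_id' ℝ T]
    rw [← cfc_mul (fun t : ℝ => t) (f μ) T (by fun_prop) (hcont μ hμ')]
    congr 1
    ext t
    by_cases h : t = μ
    · rw [h, smul_eq_mul]
    · simp [f, h]
  have h2 := congrArg (fun S : E →L[ℂ] E => S y) h1
  simp only [smul_apply] at h2
  rw [Complex.coe_smul]
  exact h2

theorem mem_singularValue_set_iff {A : E →L[ℂ] E} {ε : ℝ} (hε : 0 ≤ ε) {n : ℕ} :
    ((spectrum ℝ (CFC.abs A) ∩ Ioi ε).Finite ∧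
      Module.rank ℂ (⨆ μ ∈ Ioi ε, Module.End.eigenspace (CFC.abs A).toLinearMap (μ : ℂ) :
        Submodule ℂ E) < (n : Cardinal)) ↔ ApproxBound A n ε := by
  set T := CFC.abs A with hTdef
  have hT : 0 ≤ T := CFC.abs_nonneg A
  have hTA : T * T = A.adjoint ∘L A := CFC.abs_mul_abs A
  have hsa : IsSelfAdjoint T := IsSelfAdjoint.of_nonneg hT
  constructor
  · rintro ⟨hfin, hrank⟩
    refine ⟨_, hrank, fun x hx => ?_⟩
    rw [norm_sq_apply_eq hsa hTA]
    refine (norm_apply_le_of_excess_apply_eq_zero hT hε ?_).1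
    have h1 := hx _ (range_excess_le_iSup_eigenspace hT hfin ⟨excess T ε x, rfl⟩)
    change inner ℂ (excess T ε (excess T ε x)) x = 0 at h1
    rw [inner_apply_self_adjoint (excess_isSelfAdjoint T ε)] at h1
    exact inner_self_eq_zero.1 h1
  · intro h
    have hr := rank_range_excess_lt hT hTA hε h
    refine ⟨?_, (Submodule.rank_mono (iSup_eigenspace_le_range_excess hT ε)).trans_lt hr⟩
    have := finiteDimensional_of_rank_lt hr
    have h1 := finite_spectrum_of_finiteDimensional_range (excess T ε)
    rw [excess, cfc_map_spectrum (fun t : ℝ => max (t - ε) 0) T hsa (by fun_prop)] at h1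
    refine Finite.of_finite_image (h1.subset (image_mono inter_subset_left)) ?_
    intro s hs t ht hst
    have hs' := mem_Ioi.1 hs.2
    have ht' := mem_Ioi.1 ht.2
    simp only [max_eq_left (sub_nonneg.2 hs'.le), max_eq_left (sub_nonneg.2 ht'.le)] at hst
    linarith

theorem singularValue_eq_approxNumber (A : E →L[ℂ] E) (n : ℕ) :
    singularValue A n = approxNumber A n := by
  unfold singularValue approxNumber
  congr 1
  ext ε
  exact and_congr_right fun hε => mem_singularValue_set_iff hε

end Spectral

section Negligible

variable {E F G : Type*} [NormedAddCommGroup E] [InnerProductSpace ℂ E]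
  [NormedAddCommGroup F] [InnerProductSpace ℂ F] [NormedAddCommGroup G] [InnerProductSpace ℂ G]

theorem not_approxBound_zero {A : E →L[ℂ] F} {ε : ℝ} : ¬ ApproxBound A 0 ε := by
  rintro ⟨V, hV, -⟩
  simp at hV

/-- The approximation numbers of `A` decay faster than any power of `n`. -/
def Negligible (A : E →L[ℂ] F) : Prop :=
  ∀ M : ℕ, ∃ C : ℕ, ∀ n : ℕ, 1 ≤ n → ApproxBound A (C * n ^ 2) (C / (n : ℝ) ^ M)

theorem Negligible.add {A B : E →L[ℂ] F} (hA : Negligible A) (hB : Negligible B) :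
    Negligible (A + B) := by
  intro M
  obtain ⟨C, hC⟩ := hA M
  obtain ⟨D, hD⟩ := hB M
  refine ⟨C + D, fun n hn => ?_⟩
  convert (hC n hn).add (hD n hn) using 1
  · ring
  · push_cast; ring

theorem Negligible.comp_left {A : E →L[ℂ] F} (hA : Negligible A) (B : F →L[ℂ] G) :
    Negligible (B ∘L A) := by
  intro M
  obtain ⟨C, hC⟩ := hA M
  obtain ⟨K, hK⟩ := exists_nat_ge (‖B‖ + 1)
  have hK1 : 1 ≤ K := by
    have h : (1 : ℝ) ≤ K := le_trans (by linarith [norm_nonneg B]) hK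
    exact_mod_cast h
  refine ⟨K * C, fun n hn => ((hC n hn).comp_left B).mono ?_ ?_⟩
  · gcongr
    exact Nat.le_mul_of_pos_left _ hK1
  · rw [← mul_div_assoc]
    push_cast
    gcongr
    linarith

theorem Negligible.comp_right [CompleteSpace E] [CompleteSpace F] {A : F →L[ℂ] G}
    (hA : Negligible A) (B : E →L[ℂ] F) : Negligible (A ∘L B) := by
  intro M
  obtain ⟨C, hC⟩ := hA M
  obtain ⟨K, hK⟩ := exists_nat_ge (‖B‖ + 1)
  have hK1 : 1 ≤ K := by
    have h : (1 : ℝ) ≤ K := le_trans (by linarith [norm_nonneg B]) hK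
    exact_mod_cast h
  refine ⟨K * C, fun n hn => ((hC n hn).comp_right (by positivity) B).mono ?_ ?_⟩
  · gcongr
    exact Nat.le_mul_of_pos_left _ hK1
  · rw [div_mul_eq_mul_div, mul_comm]
    push_cast
    gcongr
    linarith

theorem Negligible.neg {A : E →L[ℂ] F} (hA : Negligible A) : Negligible (-A) := by
  have h := hA.comp_left (-ContinuousLinearMap.id ℂ F)
  simpa using h

theorem Negligible.adjoint [CompleteSpace E] [CompleteSpace F] {A : E →L[ℂ] F}
    (hA : Negligible A) : Negligible A.adjoint := by
  intro M
  obtain ⟨C, hC⟩ := hA M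
  exact ⟨C, fun n hn => (hC n hn).adjoint (by positivity)⟩

theorem Negligible.approxNumber_le {A : E →L[ℂ] F} (hA : Negligible A) (M : ℕ) :
    ∃ C : ℝ, 0 ≤ C ∧ ∀ m : ℕ, 1 ≤ m → approxNumber A m ≤ C / (m : ℝ) ^ M := by
  obtain ⟨C, hC⟩ := hA (2 * M)
  have hC1 : 1 ≤ C := by
    by_contra h
    have h0 : C = 0 := by omega
    have := hC 1 le_rfl
    rw [h0, zero_mul] at this
    exact not_approxBound_zero this
  refine ⟨max (‖A‖ * (C : ℝ) ^ M) (C * (4 * C) ^ M), by positivity, fun m hm => ?_⟩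
  have hm0 : (0 : ℝ) < m := by exact_mod_cast hm
  rcases lt_or_ge m C with h | h
  · have h1 := HankelLoc.approxNumber_le (norm_nonneg A) (approxBound_norm A hm)
    refine h1.trans ?_
    rw [le_div_iff₀ (by positivity)]
    refine le_trans ?_ (le_max_left _ _)
    gcongr
  · set n := Nat.sqrt (m / C) with hn
    have hn1 : 1 ≤ n := by
      rw [hn, Nat.le_sqrt']
      simpa using (Nat.one_le_div_iff hC1).2 h
    have h1 : C * n ^ 2 ≤ m :=
      (Nat.mul_le_mul_left C (Nat.sqrt_le' _)).trans (Nat.mul_div_le m C)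
    have h2 : m ≤ 4 * C * n ^ 2 := by
      have h3 : m / C < (n + 1) ^ 2 := Nat.lt_succ_sqrt' _
      have h4 : m < C * (n + 1) ^ 2 := by
        rw [Nat.div_lt_iff_lt_mul hC1] at h3
        linarith
      have h5 : (n + 1) ^ 2 ≤ 4 * n ^ 2 := by nlinarith
      nlinarith
    have hb := (hC n hn1).mono h1 le_rfl
    refine (HankelLoc.approxNumber_le (by positivity) hb).trans ?_
    have hn0 : (0 : ℝ) < n := by exact_mod_cast hn1
    have h2' : (m : ℝ) ≤ 4 * C * (n : ℝ) ^ 2 := by exact_mod_cast h2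
    rw [div_le_div_iff₀ (by positivity) (by positivity)]
    calc (C : ℝ) * (m : ℝ) ^ M ≤ C * (4 * C * (n : ℝ) ^ 2) ^ M := by gcongr
      _ = C * (4 * C) ^ M * (n : ℝ) ^ (2 * M) := by rw [mul_pow, ← pow_mul]; ring
      _ ≤ _ := by gcongr; exact le_max_right _ _

end Negligible

section DirectSum

variable {H : Type*} [NormedAddCommGroup H] [InnerProductSpace ℂ H]

/-- The operator `x ↦ (A x, B x)` into the Hilbert space direct sum. -/
def column (A B : H →L[ℂ] H) : H →L[ℂ] WithLp 2 (H × H) :=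
  (WithLp.prodContinuousLinearEquiv 2 ℂ H H).symm.toContinuousLinearMap ∘L A.prod B

/-- The block diagonal operator `(x, y) ↦ (A x, B y)`. -/
def blockDiag (A B : H →L[ℂ] H) : WithLp 2 (H × H) →L[ℂ] WithLp 2 (H × H) :=
  (WithLp.prodContinuousLinearEquiv 2 ℂ H H).symm.toContinuousLinearMap ∘L A.prodMap B ∘L
    (WithLp.prodContinuousLinearEquiv 2 ℂ H H).toContinuousLinearMap

/-- The first component of the direct sum. -/
def projFst : WithLp 2 (H × H) →L[ℂ] H :=
  ContinuousLinearMap.fst ℂ H H ∘L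
    (WithLp.prodContinuousLinearEquiv 2 ℂ H H).toContinuousLinearMap

/-- The second component of the direct sum. -/
def projSnd : WithLp 2 (H × H) →L[ℂ] H :=
  ContinuousLinearMap.snd ℂ H H ∘L
    (WithLp.prodContinuousLinearEquiv 2 ℂ H H).toContinuousLinearMap

@[simp] theorem column_fst (A B : H →L[ℂ] H) (x : H) : (column A B x).fst = A x := rfl
@[simp] theorem column_snd (A B : H →L[ℂ] H) (x : H) : (column A B x).snd = B x := rfl
@[simp] theorem blockDiag_fst (A B : H →L[ℂ] H) (z : WithLp 2 (H × H)) :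
    (blockDiag A B z).fst = A z.fst := rfl
@[simp] theorem blockDiag_snd (A B : H →L[ℂ] H) (z : WithLp 2 (H × H)) :
    (blockDiag A B z).snd = B z.snd := rfl

theorem ApproxBound.blockDiag {A B : H →L[ℂ] H} {n m : ℕ} {ε : ℝ} (hε : 0 ≤ ε)
    (hA : ApproxBound A n ε) (hB : ApproxBound B m ε) :
    ApproxBound (blockDiag A B) (n + m) ε := by
  obtain ⟨V, hV, hA⟩ := hA
  obtain ⟨W, hW, hB⟩ := hB
  let i₁ := column (ContinuousLinearMap.id ℂ H) 0
  let i₂ := column 0 (ContinuousLinearMap.id ℂ H)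
  refine ⟨V.map i₁.toLinearMap ⊔ W.map i₂.toLinearMap, ?_, fun z hz => ?_⟩
  · refine (Submodule.rank_add_le_rank_add_rank _ _).trans_lt ?_
    push_cast
    exact Cardinal.add_lt_add ((rank_map_le _ _).trans_lt hV) ((rank_map_le _ _).trans_lt hW)
  · rw [← Submodule.inf_orthogonal] at hz
    have h1 : z.fst ∈ Vᗮ := fun v hv => by
      simpa [i₁, WithLp.prod_inner_apply] using hz.1 _ ⟨v, hv, rfl⟩
    have h2 : z.snd ∈ Wᗮ := fun v hv => by
      simpa [i₂, WithLp.prod_inner_apply] using hz.2 _ ⟨v, hv, rfl⟩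
    refine le_of_sq_le_sq ?_ (by positivity)
    rw [WithLp.prod_norm_sq_eq_of_L2, mul_pow, WithLp.prod_norm_sq_eq_of_L2 z, mul_add, ← mul_pow, ← mul_pow, blockDiag_fst,
      blockDiag_snd]
    gcongr
    · exact hA _ h1
    · exact hB _ h2

theorem approxNumber_blockDiag_le (A B : H →L[ℂ] H) {n m : ℕ} (hn : 1 ≤ n) (hm : 1 ≤ m) :
    approxNumber (blockDiag A B) (n + m) ≤ max (approxNumber A n) (approxNumber B m) := by
  refine le_of_forall_gt_imp_ge_of_dense fun ε hε => ?_
  have h1 := (le_max_left _ _).trans_lt hε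
  have h2 := (le_max_right _ _).trans_lt hε
  have hε0 := (approxNumber_nonneg A n).trans h1.le
  exact approxNumber_le hε0
    (ApproxBound.blockDiag hε0 (approxBound_of_lt hn h1) (approxBound_of_lt hm h2))

variable [CompleteSpace H]

theorem approxBound_of_blockDiag {A B : H →L[ℂ] H} {n m : ℕ} {ε : ℝ} (hε : 0 ≤ ε)
    (h : ApproxBound (blockDiag A B) (n + m) ε) : ApproxBound A n ε ∨ ApproxBound B m ε := by
  by_contra hcon
  rw [not_or] at hcon
  obtain ⟨U, hU, hAU⟩ := exists_submodule_of_not_approxBound hε hcon.1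
  obtain ⟨W, hW, hBW⟩ := exists_submodule_of_not_approxBound hε hcon.2
  obtain ⟨V, hV, hVA⟩ := h
  have := finiteDimensional_of_rank_lt hV
  let f : (U × W) →ₗ[ℂ] WithLp 2 (H × H) :=
    (WithLp.linearEquiv 2 ℂ (H × H)).symm.toLinearMap ∘ₗ (U.subtype.prodMap W.subtype)
  have hf : Function.Injective f :=
    (WithLp.linearEquiv 2 ℂ (H × H)).symm.injective.comp
      (Prod.map_injective.2 ⟨U.injective_subtype, W.injective_subtype⟩)
  have hr : Module.rank ℂ f.range = (n + m : ℕ) := by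
    rw [rank_range_of_injective f hf, rank_prod', hU, hW]
    push_cast; rfl
  have hle : Module.rank ℂ f.range ≤ Module.rank ℂ V := by
    refine rank_le_of_disjoint_orthogonal ?_
    rw [Submodule.disjoint_def]
    rintro _ ⟨⟨u, w⟩, rfl⟩ hz
    have h1 := hVA _ hz
    have h2 : ‖blockDiag A B (f (u, w))‖ ^ 2 ≤ (ε * ‖f (u, w)‖) ^ 2 := by gcongr
    rw [WithLp.prod_norm_sq_eq_of_L2, mul_pow, WithLp.prod_norm_sq_eq_of_L2 (f (u, w)), mul_add, ← mul_pow, ← mul_pow] at h2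
    change ‖A u‖ ^ 2 + ‖B w‖ ^ 2 ≤ (ε * ‖(u : H)‖) ^ 2 + (ε * ‖(w : H)‖) ^ 2 at h2
    have h3 : ‖A u‖ ≤ ε * ‖(u : H)‖ ∨ ‖B w‖ ≤ ε * ‖(w : H)‖ := by
      by_contra! hlt
      have := pow_lt_pow_left₀ hlt.1 (by positivity) two_ne_zero
      have := pow_lt_pow_left₀ hlt.2 (by positivity) two_ne_zero
      linarith
    have h4 : u = 0 ∧ w = 0 := by
      rcases h3 with h3 | h3
      · have hu := hAU u u.2 h3
        rw [hu] at h2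
        refine ⟨Subtype.ext hu, Subtype.ext (hBW w w.2 (le_of_sq_le_sq ?_ (by positivity)))⟩
        simpa using h2
      · have hw := hBW w w.2 h3
        rw [hw] at h2
        refine ⟨Subtype.ext (hAU u u.2 (le_of_sq_le_sq ?_ (by positivity))), Subtype.ext hw⟩
        simpa using h2
    rw [h4.1, h4.2]
    exact map_zero f
  rw [hr] at hle
  exact absurd hV (not_lt.2 hle)

theorem le_approxNumber_blockDiag (A B : H →L[ℂ] H) {n m : ℕ} (hnm : 1 ≤ n + m) :
    min (approxNumber A n) (approxNumber B m) ≤ approxNumber (blockDiag A B) (n + m) := by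
  refine le_of_forall_gt_imp_ge_of_dense fun ε hε => ?_
  have hε0 := (approxNumber_nonneg _ _).trans hε.le
  rcases approxBound_of_blockDiag hε0 (approxBound_of_lt hnm hε) with h | h
  · exact (min_le_left _ _).trans (approxNumber_le hε0 h)
  · exact (min_le_right _ _).trans (approxNumber_le hε0 h)

theorem le_approxNumber_blockDiag_left (A B : H →L[ℂ] H) {n : ℕ} (hn : 1 ≤ n) :
    approxNumber A n ≤ approxNumber (blockDiag A B) n := by
  refine le_of_forall_gt_imp_ge_of_dense fun ε hε => ?_
  have hε0 := (approxNumber_nonneg _ _).trans hε.le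
  rcases approxBound_of_blockDiag (n := n) (m := 0) hε0 (approxBound_of_lt hn hε) with h | h
  · exact approxNumber_le hε0 h
  · exact absurd h not_approxBound_zero

theorem le_approxNumber_blockDiag_right (A B : H →L[ℂ] H) {n : ℕ} (hn : 1 ≤ n) :
    approxNumber B n ≤ approxNumber (blockDiag A B) n := by
  refine le_of_forall_gt_imp_ge_of_dense fun ε hε => ?_
  have hε0 := (approxNumber_nonneg _ _).trans hε.le
  rcases approxBound_of_blockDiag (n := 0) (m := n) hε0
    (by rw [zero_add]; exact approxBound_of_lt hn hε) with h | h
  · exact absurd h not_approxBound_zero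
  · exact approxNumber_le hε0 h

theorem adjoint_column_apply (A B : H →L[ℂ] H) (z : WithLp 2 (H × H)) :
    (column A B).adjoint z = A.adjoint z.fst + B.adjoint z.snd := by
  refine ext_inner_right ℂ fun y => ?_
  rw [ContinuousLinearMap.adjoint_inner_left, inner_add_left,
    ContinuousLinearMap.adjoint_inner_left, ContinuousLinearMap.adjoint_inner_left,
    WithLp.prod_inner_apply]
  rfl

theorem adjoint_column_comp_column (A B : H →L[ℂ] H) :
    (column A B).adjoint ∘L column A B = A.adjoint ∘L A + B.adjoint ∘L B := by
  ext x
  simp [adjoint_column_apply]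

theorem column_comp_adjoint_column (A B : H →L[ℂ] H) :
    column A B ∘L (column A B).adjoint =
      blockDiag (A ∘L A.adjoint) (B ∘L B.adjoint) +
        (column (ContinuousLinearMap.id ℂ H) 0 ∘L (A ∘L B.adjoint) ∘L projSnd +
          column 0 (ContinuousLinearMap.id ℂ H) ∘L (B ∘L A.adjoint) ∘L projFst) := by
  refine ContinuousLinearMap.ext fun z => WithLp.ofLp_injective 2 (Prod.ext ?_ ?_)
  · change A _ = A (A.adjoint z.fst) + (A (B.adjoint z.snd) + 0)
    simp [adjoint_column_apply]
  · change B _ = B (B.adjoint z.snd) + (0 + B (A.adjoint z.fst))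
    simp [adjoint_column_apply, add_comm]

end DirectSum

section Sequences

/-- The sequence `n * x n ^ q`. -/
def weighted (q : ℝ) (x : ℕ → ℝ) (n : ℕ) : ℝ≥0∞ := (n : ℝ≥0∞) * ENNReal.ofReal (x n) ^ q

theorem weighted_eq_ofReal {q : ℝ} (hq : 0 < q) {x : ℕ → ℝ} (hx : ∀ n, 0 ≤ x n) (n : ℕ) :
    weighted q x n = ENNReal.ofReal (n * x n ^ q) := by
  rw [weighted, ENNReal.ofReal_mul (by positivity), ENNReal.ofReal_natCast,
    ENNReal.ofReal_rpow_of_nonneg (hx n) hq.le]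

theorem add_rpow_le_of_pos {q a b δ : ℝ} (hq : 0 < q) (ha : 0 ≤ a) (hb : 0 ≤ b) (hδ : 0 < δ) :
    (a + b) ^ q ≤ (1 + δ) ^ q * a ^ q + ((1 + δ⁻¹) * b) ^ q := by
  rcases le_total b (δ * a) with h | h
  · have h1 : (a + b) ^ q ≤ ((1 + δ) * a) ^ q := by
      gcongr
      linarith
    rw [Real.mul_rpow (by positivity) ha] at h1
    have : 0 ≤ ((1 + δ⁻¹) * b) ^ q := by positivity
    linarith
  · have h1 : (a + b) ^ q ≤ ((1 + δ⁻¹) * b) ^ q := by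
      gcongr
      have : a ≤ δ⁻¹ * b := by rwa [inv_mul_eq_div, le_div_iff₀ hδ, mul_comm]
      linarith
    have : 0 ≤ (1 + δ) ^ q * a ^ q := by positivity
    linarith

theorem weighted_add_le {q : ℝ} (hq : 0 < q) {x y k : ℕ → ℝ} (hx : ∀ n, 0 ≤ x n)
    (hy : ∀ n, 0 ≤ y n) (hk0 : ∀ n, 0 ≤ k n)
    (hxy : ∀ n m, 1 ≤ n → 1 ≤ m → y (n + m) ≤ x n + k m)
    (hk : ∀ M : ℕ, ∃ C : ℝ, 0 ≤ C ∧ ∀ m : ℕ, 1 ≤ m → k m ≤ C / (m : ℝ) ^ M)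
    {j : ℕ} (hj : 1 ≤ j) : ∃ C : ℝ, 0 ≤ C ∧ ∀ n m : ℕ, 1 ≤ n → 1 ≤ m →
      j * (n + m) ≤ (j + 1) * n → n + m ≤ 2 * (j + 1) * m →
      weighted q y (n + m) ≤
        ENNReal.ofReal ((1 + (j : ℝ)⁻¹) * (1 + (j : ℝ)⁻¹) ^ q) * weighted q x n +
          ENNReal.ofReal (C / ((n + m : ℕ) : ℝ)) := by
  obtain ⟨M, hM⟩ := exists_nat_ge (2 / q)
  obtain ⟨C, hC0, hC⟩ := hk M
  have hMq : 2 ≤ M * q := by rwa [div_le_iff₀ hq] at hM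
  have hj0 : (0 : ℝ) < j := by exact_mod_cast hj
  set D : ℝ := (1 + (j : ℝ)) * (C * (2 * (j + 1)) ^ M) with hD
  have hD0 : 0 ≤ D := by positivity
  refine ⟨D ^ q, by positivity, fun n m hn hm h1 h2 => ?_⟩
  rw [weighted_eq_ofReal hq hx, weighted_eq_ofReal hq hy, ← ENNReal.ofReal_mul (by positivity),
    ← ENNReal.ofReal_add (by have := hx n; positivity) (by positivity)]
  apply ENNReal.ofReal_le_ofReal
  set N := n + m with hN
  have hn0 : (0 : ℝ) < n := by exact_mod_cast hn
  have hm0 : (0 : ℝ) < m := by exact_mod_cast hm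
  have hN1 : (1 : ℝ) ≤ N := by exact_mod_cast (by omega : 1 ≤ N)
  have hN0 : (0 : ℝ) < N := by linarith
  have h1' : (N : ℝ) ≤ (1 + (j : ℝ)⁻¹) * n := by
    have : (j : ℝ) * N ≤ (j + 1) * n := by exact_mod_cast h1
    have e : (1 + (j : ℝ)⁻¹) * n = (j + 1) * n / j := by field_simp
    rw [e, le_div_iff₀ hj0]
    linarith
  have h2' : (N : ℝ) ≤ 2 * (j + 1) * m := by exact_mod_cast h2
  have hxn := hx n
  have hkm := hk0 m
  have hkD : (1 + (j : ℝ)) * k m ≤ D / (N : ℝ) ^ M := by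
    rw [hD, mul_div_assoc]
    gcongr
    refine (hC m hm).trans ?_
    rw [div_le_div_iff₀ (by positivity) (by positivity), mul_assoc, ← mul_pow]
    gcongr
  have hsmall : N * ((1 + (j : ℝ)) * k m) ^ q ≤ D ^ q / N := by
    have h3 : ((1 + (j : ℝ)) * k m) ^ q ≤ D ^ q / (N : ℝ) ^ (2 : ℝ) := by
      calc ((1 + (j : ℝ)) * k m) ^ q ≤ (D / (N : ℝ) ^ M) ^ q := by gcongr
        _ = D ^ q / (N : ℝ) ^ (M * q) := by
          rw [Real.div_rpow hD0 (by positivity), ← Real.rpow_natCast, ← Real.rpow_mul hN0.le]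
        _ ≤ _ := by gcongr
    calc N * ((1 + (j : ℝ)) * k m) ^ q ≤ N * (D ^ q / (N : ℝ) ^ (2 : ℝ)) := by gcongr
      _ = D ^ q / N := by
        rw [Real.rpow_two]; field_simp
  calc N * y N ^ q ≤ N * (x n + k m) ^ q := by
        gcongr
        · exact hy _
        · exact hxy n m hn hm
    _ ≤ N * ((1 + (j : ℝ)⁻¹) ^ q * x n ^ q + ((1 + (j : ℝ)) * k m) ^ q) := by
        gcongr
        simpa using add_rpow_le_of_pos hq hxn hkm (inv_pos.2 hj0)
    _ = N * ((1 + (j : ℝ)⁻¹) ^ q * x n ^ q) + N * ((1 + (j : ℝ)) * k m) ^ q := by ring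
    _ ≤ ((1 + (j : ℝ)⁻¹) * n) * ((1 + (j : ℝ)⁻¹) ^ q * x n ^ q) + D ^ q / N := by
        gcongr
    _ = _ := by ring

theorem le_of_forall_le_ofReal_mul {q : ℝ} {S T : ℝ≥0∞}
    (h : ∀ j : ℕ, 1 ≤ j → S ≤ ENNReal.ofReal ((1 + (j : ℝ)⁻¹) * (1 + (j : ℝ)⁻¹) ^ q) * T) :
    S ≤ T := by
  have h1 : Tendsto (fun j : ℕ => (1 + (j : ℝ)⁻¹)) atTop (nhds 1) := by
    simpa using (tendsto_inv_atTop_nhds_zero_nat (𝕜 := ℝ)).const_add 1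
  have h2 : Tendsto (fun j : ℕ => ENNReal.ofReal ((1 + (j : ℝ)⁻¹) * (1 + (j : ℝ)⁻¹) ^ q) * T) atTop
      (nhds T) := by
    have h3 := ENNReal.tendsto_ofReal (h1.mul (h1.rpow_const (p := q) (Or.inl one_ne_zero)))
    simp only [Real.one_rpow, mul_one, ENNReal.ofReal_one] at h3
    simpa using ENNReal.Tendsto.mul_const h3 (Or.inl one_ne_zero)
  exact ge_of_tendsto h2 (by filter_upwards [eventually_ge_atTop 1] with j hj using h j hj)

theorem tendsto_ofReal_div_nat (C : ℝ) :
    Tendsto (fun N : ℕ => ENNReal.ofReal (C / (N : ℝ))) atTop (nhds 0) := by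
  simpa using ENNReal.tendsto_ofReal (tendsto_const_div_atTop_nhds_zero_nat C)

theorem limsup_weighted_le {q : ℝ} (hq : 0 < q) {x y k : ℕ → ℝ} (hx : ∀ n, 0 ≤ x n)
    (hy : ∀ n, 0 ≤ y n) (hk0 : ∀ n, 0 ≤ k n)
    (hxy : ∀ n m, 1 ≤ n → 1 ≤ m → y (n + m) ≤ x n + k m)
    (hk : ∀ M : ℕ, ∃ C : ℝ, 0 ≤ C ∧ ∀ m : ℕ, 1 ≤ m → k m ≤ C / (m : ℝ) ^ M) :
    limsup (weighted q y) atTop ≤ limsup (weighted q x) atTop := by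
  refine le_of_forall_le_ofReal_mul (q := q) fun j hj => ?_
  obtain ⟨C, hC0, hC⟩ := weighted_add_le hq hx hy hk0 hxy hk hj
  set c := ENNReal.ofReal ((1 + (j : ℝ)⁻¹) * (1 + (j : ℝ)⁻¹) ^ q)
  have hdiv : ∀ N : ℕ, (j + 1) * (N / (j + 1)) ≤ N := fun N => Nat.mul_div_le N (j + 1)
  have hn : Tendsto (fun N : ℕ => N - N / (j + 1)) atTop atTop := by
    refine tendsto_atTop.2 fun b => ?_
    filter_upwards [eventually_ge_atTop (2 * b)] with N hN
    have : 2 * (N / (j + 1)) ≤ N :=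
      (Nat.mul_le_mul_right _ (by omega : 2 ≤ j + 1)).trans (hdiv N)
    omega
  have hev : ∀ᶠ N in atTop, weighted q y N ≤
      c * weighted q x (N - N / (j + 1)) + ENNReal.ofReal (C / (N : ℝ)) := by
    filter_upwards [eventually_ge_atTop (j + 1), hn.eventually_ge_atTop 1] with N hN hN'
    have hm : 1 ≤ N / (j + 1) := (Nat.one_le_div_iff (by omega)).2 hN
    have hlt : N < (j + 1) * (N / (j + 1) + 1) := Nat.lt_mul_div_succ N (by omega)
    have hsum : N - N / (j + 1) + N / (j + 1) = N := by omega
    have h := hC (N - N / (j + 1)) (N / (j + 1)) hN' hm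
    rw [hsum] at h
    refine h ?_ ?_
    · have := hdiv N
      zify [Nat.div_le_self N (j + 1)] at *
      nlinarith
    · nlinarith
  calc limsup (weighted q y) atTop
      ≤ limsup (fun N => c * weighted q x (N - N / (j + 1)) + ENNReal.ofReal (C / (N : ℝ))) atTop :=
        limsup_le_limsup hev
    _ = limsup (fun N => c * weighted q x (N - N / (j + 1))) atTop :=
        ENNReal.limsup_add_of_right_tendsto_zero (tendsto_ofReal_div_nat C) _
    _ = c * limsup (fun N => weighted q x (N - N / (j + 1))) atTop :=
        ENNReal.limsup_const_mul_of_ne_top ENNReal.ofReal_ne_top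
    _ ≤ c * limsup (weighted q x) atTop := by
        gcongr
        exact (limsup_comp (weighted q x) (fun N => N - N / (j + 1)) atTop).trans_le
          (limsup_le_limsup_of_le hn)

theorem liminf_weighted_le {q : ℝ} (hq : 0 < q) {x y k : ℕ → ℝ} (hx : ∀ n, 0 ≤ x n)
    (hy : ∀ n, 0 ≤ y n) (hk0 : ∀ n, 0 ≤ k n)
    (hxy : ∀ n m, 1 ≤ n → 1 ≤ m → y (n + m) ≤ x n + k m)
    (hk : ∀ M : ℕ, ∃ C : ℝ, 0 ≤ C ∧ ∀ m : ℕ, 1 ≤ m → k m ≤ C / (m : ℝ) ^ M) :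
    liminf (weighted q y) atTop ≤ liminf (weighted q x) atTop := by
  refine le_of_forall_le_ofReal_mul (q := q) fun j hj => ?_
  obtain ⟨C, hC0, hC⟩ := weighted_add_le hq hx hy hk0 hxy hk hj
  set c := ENNReal.ofReal ((1 + (j : ℝ)⁻¹) * (1 + (j : ℝ)⁻¹) ^ q)
  have hN : Tendsto (fun n : ℕ => n + n / j) atTop atTop :=
    tendsto_atTop_mono (fun n => Nat.le_add_right n (n / j)) tendsto_id
  have hev : ∀ᶠ n in atTop, weighted q y (n + n / j) ≤
      c * weighted q x n + ENNReal.ofReal (C / ((n + n / j : ℕ) : ℝ)) := by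
    filter_upwards [eventually_ge_atTop j] with n hn
    have hm : 1 ≤ n / j := (Nat.one_le_div_iff (by omega)).2 hn
    have hlt : n < j * (n / j + 1) := Nat.lt_mul_div_succ n (by omega)
    refine hC n (n / j) (by omega) hm ?_ ?_
    · have := Nat.mul_div_le n j
      nlinarith
    · nlinarith
  have hz : Tendsto (fun n : ℕ => ENNReal.ofReal (C / ((n + n / j : ℕ) : ℝ))) atTop (nhds 0) :=
    (tendsto_ofReal_div_nat C).comp hN
  calc liminf (weighted q y) atTop
      ≤ liminf (fun n => weighted q y (n + n / j)) atTop :=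
        (liminf_le_liminf_of_le hN).trans_eq
          (liminf_comp (weighted q y) (fun n => n + n / j) atTop).symm
    _ ≤ liminf (fun n => c * weighted q x n + ENNReal.ofReal (C / ((n + n / j : ℕ) : ℝ))) atTop :=
        liminf_le_liminf hev
    _ = liminf (fun n => c * weighted q x n) atTop :=
        ENNReal.liminf_add_of_right_tendsto_zero hz _
    _ = c * liminf (weighted q x) atTop :=
        ENNReal.liminf_const_mul_of_ne_top ENNReal.ofReal_ne_top

theorem limsup_weighted_le_add {q : ℝ} (hq : 0 < q) {x y z : ℕ → ℝ} (hx : ∀ n, 0 ≤ x n)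
    (hy : ∀ n, 0 ≤ y n) (hz : ∀ n, 0 ≤ z n)
    (h : ∀ n m, 1 ≤ n → 1 ≤ m → y (n + m) ≤ max (x n) (z m)) :
    limsup (weighted q y) atTop ≤ limsup (weighted q x) atTop + limsup (weighted q z) atTop := by
  set S := limsup (weighted q x) atTop with hS
  set T := limsup (weighted q z) atTop with hT
  by_cases hS' : S = ∞
  · simp [hS']
  by_cases hT' : T = ∞
  · simp [hT']
  have key : ∀ {w : ℕ → ℝ} (_ : ∀ n, 0 ≤ w n) (_ : limsup (weighted q w) atTop ≠ ∞) {a : ℝ},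
      (limsup (weighted q w) atTop).toReal < a → ∀ᶠ n : ℕ in atTop, n * w n ^ q < a := by
    intro w hw hfin a ha
    have h1 := eventually_lt_of_limsup_lt ((ENNReal.lt_ofReal_iff_toReal_lt hfin).2 ha)
    filter_upwards [h1] with n hn
    rw [weighted_eq_ofReal hq hw] at hn
    exact ENNReal.ofReal_lt_ofReal_iff_of_nonneg (by have := hw n; positivity) |>.1 hn
  refine ENNReal.le_of_forall_pos_le_add fun ε hε _ => ?_
  have hε' : (0 : ℝ) < ε := hε
  set A : ℝ := S.toReal + ε / 2 with hA
  set B : ℝ := T.toReal + ε / 2 with hB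
  have hA0 : 0 < A := by positivity
  have hB0 : 0 < B := by positivity
  have hAB : S + T + ε = ENNReal.ofReal (A + B) := by
    rw [hA, hB, show S.toReal + (ε : ℝ) / 2 + (T.toReal + ε / 2) = S.toReal + T.toReal + ε by ring,
      ENNReal.ofReal_add (by positivity) (by positivity),
      ENNReal.ofReal_add (by positivity) (by positivity), ENNReal.ofReal_toReal hS',
      ENNReal.ofReal_toReal hT', ENNReal.ofReal_coe_nnreal]
  rw [hAB]
  set a : ℝ := S.toReal + ε / 4 with ha
  have hx' := key hx hS' (show S.toReal < a by linarith)
  have hz' := key hz hT' (show T.toReal < B by linarith)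
  have hfl : Tendsto (fun N : ℕ => ⌊(N : ℝ) * (A / (A + B))⌋₊) atTop atTop :=
    tendsto_nat_floor_atTop.comp
      (tendsto_natCast_atTop_atTop.atTop_mul_const (by positivity))
  have hle : ∀ N : ℕ, (⌊(N : ℝ) * (A / (A + B))⌋₊ : ℝ) ≤ N * (A / (A + B)) := fun N =>
    Nat.floor_le (by positivity)
  have hlin : ∀ N : ℕ, (N : ℝ) * (A / (A + B)) = N - N * (B / (A + B)) := fun N => by
    field_simp; ring
  have hle' : ∀ N : ℕ, ⌊(N : ℝ) * (A / (A + B))⌋₊ ≤ N := fun N => by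
    have h1 := hle N
    have : 0 ≤ N * (B / (A + B)) := by positivity
    have h2 := hlin N
    exact_mod_cast (by linarith : (⌊(N : ℝ) * (A / (A + B))⌋₊ : ℝ) ≤ N)
  have hsub : ∀ N : ℕ, (N : ℝ) * (B / (A + B)) ≤ ((N - ⌊(N : ℝ) * (A / (A + B))⌋₊ : ℕ) : ℝ) := by
    intro N
    rw [Nat.cast_sub (hle' N)]
    have h1 := hle N
    have h2 := hlin N
    linarith
  have hm : Tendsto (fun N : ℕ => N - ⌊(N : ℝ) * (A / (A + B))⌋₊) atTop atTop := by
    refine tendsto_natCast_atTop_iff (R := ℝ) |>.1 (tendsto_atTop_mono hsub ?_)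
    exact tendsto_natCast_atTop_atTop.atTop_mul_const (by positivity)
  refine limsup_le_of_le (by isBoundedDefault) ?_
  obtain ⟨N₀, hN₀⟩ := exists_nat_ge ((A + B) / (A - a))
  filter_upwards [hfl.eventually hx', hm.eventually hz', hfl.eventually_ge_atTop 1,
    hm.eventually_ge_atTop 1, eventually_ge_atTop N₀, eventually_ge_atTop 1]
    with N h1 h2 h3 h4 h5 h6
  set n := ⌊(N : ℝ) * (A / (A + B))⌋₊ with hn
  rw [weighted_eq_ofReal hq hy]
  apply ENNReal.ofReal_le_ofReal
  have hsum : n + (N - n) = N := by have := hle' N; omega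
  have hN0 : (0 : ℝ) < N := by exact_mod_cast h6
  have hn0 : (0 : ℝ) < n := by exact_mod_cast h3
  have hm0 : (0 : ℝ) < ((N - n : ℕ) : ℝ) := by exact_mod_cast h4
  have hyN : y N ≤ max (x n) (z (N - n)) := by
    have := h n (N - n) h3 h4
    rwa [hsum] at this
  have hAa : 0 < A - a := by rw [hA, ha]; linarith
  have hAB0 : 0 < A + B := by positivity
  have hNx : N * x n ^ q ≤ A + B := by
    have h7 : (N : ℝ) * (A / (A + B)) < n + 1 := Nat.lt_floor_add_one _
    have h8 : (A + B) ≤ N * (A - a) := by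
      rw [div_le_iff₀ hAa] at hN₀
      refine hN₀.trans ?_
      gcongr
    have h9 : N * a ≤ n * (A + B) := by
      rw [mul_div_assoc', div_lt_iff₀ hAB0] at h7
      nlinarith
    have h10 : n * (N * x n ^ q) ≤ n * (A + B) := by
      calc n * (N * x n ^ q) = N * (n * x n ^ q) := by ring
        _ ≤ N * a := by gcongr
        _ ≤ _ := h9
    exact le_of_mul_le_mul_left h10 hn0
  have hNz : N * z (N - n) ^ q ≤ A + B := by
    have h7 := hsub N
    rw [← hn, mul_div_assoc', div_le_iff₀ hAB0] at h7
    have h10 : ((N - n : ℕ) : ℝ) * (N * z (N - n) ^ q) ≤ ((N - n : ℕ) : ℝ) * (A + B) := by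
      calc ((N - n : ℕ) : ℝ) * (N * z (N - n) ^ q)
          = N * (((N - n : ℕ) : ℝ) * z (N - n) ^ q) := by ring
        _ ≤ N * B := by gcongr
        _ ≤ _ := h7
    exact le_of_mul_le_mul_left h10 hm0
  have hyNq : y N ^ q ≤ max (x n) (z (N - n)) ^ q := by
    gcongr
    exact hy N
  rcases max_choice (x n) (z (N - n)) with hc | hc <;> rw [hc] at hyNq
  · exact le_trans (by gcongr) hNx
  · exact le_trans (by gcongr) hNz

theorem ennreal_add_le_of_forall_lt {S T K : ℝ≥0∞} (hS : 0 < S) (hT : 0 < T)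
    (h : ∀ c < S, ∀ d < T, c + d ≤ K) : S + T ≤ K := by
  have h1 : ∀ d < T, S + d ≤ K := by
    intro d hd
    have hdK : d ≤ K := by simpa using h 0 hS d hd
    rw [← tsub_add_cancel_of_le hdK]
    gcongr
    exact le_of_forall_lt_imp_le_of_dense fun c hc =>
      ENNReal.le_sub_of_add_le_right hd.ne_top (h c hc d hd)
  have hSK : S ≤ K := by simpa using h1 0 hT
  by_cases hS' : S = ∞
  · rw [hS', top_le_iff] at hSK
    simp [hSK]
  · rw [← tsub_add_cancel_of_le hSK, add_comm S]
    gcongr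
    refine le_of_forall_lt_imp_le_of_dense fun d hd =>
      ENNReal.le_sub_of_add_le_right hS' ?_
    rw [add_comm]
    exact h1 d hd

theorem add_liminf_le_liminf_weighted {q : ℝ} (hq : 0 < q) {x y z : ℕ → ℝ} (hx : ∀ n, 0 ≤ x n)
    (hy : ∀ n, 0 ≤ y n) (hz : ∀ n, 0 ≤ z n)
    (hanti : ∀ n m, 1 ≤ n → n ≤ m → y m ≤ y n)
    (hxy : ∀ n, 1 ≤ n → x n ≤ y n) (hzy : ∀ n, 1 ≤ n → z n ≤ y n)
    (h : ∀ n m, 1 ≤ n + m → min (x n) (z m) ≤ y (n + m)) :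
    liminf (weighted q x) atTop + liminf (weighted q z) atTop ≤ liminf (weighted q y) atTop := by
  have hmono : ∀ {w : ℕ → ℝ}, (∀ n, 1 ≤ n → w n ≤ y n) →
      liminf (weighted q w) atTop ≤ liminf (weighted q y) atTop := by
    intro w hw
    refine liminf_le_liminf ?_
    filter_upwards [eventually_ge_atTop 1] with n hn
    unfold weighted
    gcongr
    exact hw n hn
  have key : ∀ {w : ℕ → ℝ} (_ : ∀ n, 0 ≤ w n) {a : ℝ}, 0 ≤ a →
      ENNReal.ofReal a < liminf (weighted q w) atTop → ∀ᶠ n : ℕ in atTop, a < n * w n ^ q := by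
    intro w hw a ha0 ha
    filter_upwards [eventually_lt_of_lt_liminf ha] with n hn
    rw [weighted_eq_ofReal hq hw] at hn
    exact ENNReal.ofReal_lt_ofReal_iff_of_nonneg ha0 |>.1 hn
  set S := liminf (weighted q x) atTop with hS
  set T := liminf (weighted q z) atTop with hT
  rcases eq_zero_or_pos S with hS0 | hS0
  · rw [hS0, zero_add]; exact hmono hzy
  rcases eq_zero_or_pos T with hT0 | hT0
  · rw [hT0, add_zero]; exact hmono hxy
  have main : ∀ a b : ℝ, 0 < a → 0 < b → ENNReal.ofReal a < S → ENNReal.ofReal b < T →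
      ENNReal.ofReal a + ENNReal.ofReal b ≤ liminf (weighted q y) atTop := by
    intro a b ha hb haS hbT
    have hab : 0 < a + b := by positivity
    rw [← ENNReal.ofReal_add ha.le hb.le]
    have hlim : Tendsto (fun N : ℕ => ENNReal.ofReal ((a + b) * (N / (N + 1)))) atTop
        (nhds (ENNReal.ofReal (a + b))) := by
      have := (tendsto_natCast_div_add_atTop (1 : ℝ)).const_mul (a + b)
      rw [mul_one] at this
      exact ENNReal.tendsto_ofReal this
    rw [← hlim.liminf_eq]
    refine liminf_le_liminf ?_
    have hfl : ∀ c : ℝ, 0 < c → Tendsto (fun N : ℕ => ⌊((N : ℝ) + 1) * c⌋₊) atTop atTop :=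
      fun c hc => tendsto_nat_floor_atTop.comp
        ((tendsto_natCast_atTop_atTop.atTop_add tendsto_const_nhds).atTop_mul_const hc)
    have hfa := hfl (a / (a + b)) (by positivity)
    have hfb := hfl (b / (a + b)) (by positivity)
    filter_upwards [hfa.eventually (key hx ha.le haS), hfb.eventually (key hz hb.le hbT),
      hfa.eventually_ge_atTop 1, hfb.eventually_ge_atTop 1, eventually_ge_atTop 1]
      with N h1 h2 h3 h4 h5
    set n := ⌊((N : ℝ) + 1) * (a / (a + b))⌋₊ with hn
    set m := ⌊((N : ℝ) + 1) * (b / (a + b))⌋₊ with hm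
    have hn1 : (n : ℝ) ≤ (N + 1) * (a / (a + b)) := Nat.floor_le (by positivity)
    have hm1 : (m : ℝ) ≤ (N + 1) * (b / (a + b)) := Nat.floor_le (by positivity)
    have hn2 : ((N : ℝ) + 1) * (a / (a + b)) < n + 1 := Nat.lt_floor_add_one _
    have hm2 : ((N : ℝ) + 1) * (b / (a + b)) < m + 1 := Nat.lt_floor_add_one _
    have hlin : ((N : ℝ) + 1) * (a / (a + b)) + ((N : ℝ) + 1) * (b / (a + b)) = N + 1 := by
      field_simp
    have hNnm : N ≤ n + m := by
      have : (N : ℝ) < n + m + 1 := by linarith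
      have : N < n + m + 1 := by exact_mod_cast this
      omega
    rw [weighted_eq_ofReal hq hy]
    apply ENNReal.ofReal_le_ofReal
    have hn0 : (0 : ℝ) < n := by exact_mod_cast h3
    have hm0 : (0 : ℝ) < m := by exact_mod_cast h4
    have hxn : a + b ≤ (N + 1) * x n ^ q := by
      rw [mul_div_assoc', le_div_iff₀ hab] at hn1
      have : n * (a + b) ≤ n * ((N + 1) * x n ^ q) := by
        calc n * (a + b) ≤ (N + 1) * a := hn1
          _ ≤ (N + 1) * (n * x n ^ q) := by gcongr
          _ = _ := by ring
      exact le_of_mul_le_mul_left this hn0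
    have hzm : a + b ≤ (N + 1) * z m ^ q := by
      rw [mul_div_assoc', le_div_iff₀ hab] at hm1
      have : m * (a + b) ≤ m * ((N + 1) * z m ^ q) := by
        calc m * (a + b) ≤ (N + 1) * b := hm1
          _ ≤ (N + 1) * (m * z m ^ q) := by gcongr
          _ = _ := by ring
      exact le_of_mul_le_mul_left this hm0
    have hyN : min (x n) (z m) ≤ y N :=
      (h n m (by omega)).trans (hanti N (n + m) h5 hNnm)
    have hyq : a + b ≤ (N + 1) * y N ^ q := by
      rcases min_choice (x n) (z m) with hc | hc <;> rw [hc] at hyN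
      · refine hxn.trans ?_
        gcongr
        exact hx n
      · refine hzm.trans ?_
        gcongr
        exact hz m
    rw [mul_div_assoc', div_le_iff₀ (by positivity)]
    calc (a + b) * N ≤ (N + 1) * y N ^ q * N := by gcongr
      _ = _ := by ring
  have pos : ∀ {U c : ℝ≥0∞}, 0 < U → c < U → ∃ a : ℝ, 0 < a ∧ c ≤ ENNReal.ofReal a ∧
      ENNReal.ofReal a < U := by
    intro U c hU hc
    obtain ⟨d, hd1, hd2⟩ := exists_between hc
    have hd : d ≠ ∞ := hd2.ne_top
    refine ⟨d.toReal, ENNReal.toReal_pos (bot_le.trans_lt hd1).ne' hd, ?_, ?_⟩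
    · rw [ENNReal.ofReal_toReal hd]; exact hd1.le
    · rw [ENNReal.ofReal_toReal hd]; exact hd2
  refine ennreal_add_le_of_forall_lt hS0 hT0 fun c hc d hd => ?_
  obtain ⟨a, ha0, ha1, ha2⟩ := pos hS0 hc
  obtain ⟨b, hb0, hb1, hb2⟩ := pos hT0 hd
  exact (add_le_add ha1 hb1).trans (main a b ha0 hb0 ha2 hb2)

end Sequences

section Asymptotics

variable {E F : Type*} [NormedAddCommGroup E] [InnerProductSpace ℂ E]
  [NormedAddCommGroup F] [InnerProductSpace ℂ F]

/-- `limsup n * s n ^ q` for the approximation numbers. -/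
def upperLim (q : ℝ) (A : E →L[ℂ] F) : ℝ≥0∞ := limsup (weighted q (approxNumber A)) atTop

/-- `liminf n * s n ^ q` for the approximation numbers. -/
def lowerLim (q : ℝ) (A : E →L[ℂ] F) : ℝ≥0∞ := liminf (weighted q (approxNumber A)) atTop

theorem upperLim_add_le {q : ℝ} (hq : 0 < q) (A : E →L[ℂ] F) {K : E →L[ℂ] F}
    (hK : Negligible K) : upperLim q (A + K) ≤ upperLim q A :=
  limsup_weighted_le hq (approxNumber_nonneg _) (approxNumber_nonneg _) (approxNumber_nonneg K)
    (fun _ _ hn hm => approxNumber_add_le A K hn hm) hK.approxNumber_le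

theorem lowerLim_add_le {q : ℝ} (hq : 0 < q) (A : E →L[ℂ] F) {K : E →L[ℂ] F}
    (hK : Negligible K) : lowerLim q (A + K) ≤ lowerLim q A :=
  liminf_weighted_le hq (approxNumber_nonneg _) (approxNumber_nonneg _) (approxNumber_nonneg K)
    (fun _ _ hn hm => approxNumber_add_le A K hn hm) hK.approxNumber_le

theorem upperLim_add_negligible {q : ℝ} (hq : 0 < q) (A : E →L[ℂ] F) {K : E →L[ℂ] F}
    (hK : Negligible K) : upperLim q (A + K) = upperLim q A := by
  refine le_antisymm (upperLim_add_le hq A hK) ?_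
  simpa using upperLim_add_le hq (A + K) hK.neg

theorem lowerLim_add_negligible {q : ℝ} (hq : 0 < q) (A : E →L[ℂ] F) {K : E →L[ℂ] F}
    (hK : Negligible K) : lowerLim q (A + K) = lowerLim q A := by
  refine le_antisymm (lowerLim_add_le hq A hK) ?_
  simpa using lowerLim_add_le hq (A + K) hK.neg

variable [CompleteSpace E] [CompleteSpace F]

theorem weighted_adjoint_comp_self (q : ℝ) (A : E →L[ℂ] F) :
    weighted (q / 2) (approxNumber (A.adjoint ∘L A)) =ᶠ[atTop] weighted q (approxNumber A) := by
  filter_upwards [eventually_ge_atTop 1] with n hn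
  rw [weighted, weighted, approxNumber_adjoint_comp_self A hn,
    ENNReal.ofReal_pow (approxNumber_nonneg A n), ← ENNReal.rpow_natCast, ← ENNReal.rpow_mul]
  congr 2
  push_cast
  ring

theorem upperLim_adjoint_comp_self (q : ℝ) (A : E →L[ℂ] F) :
    upperLim (q / 2) (A.adjoint ∘L A) = upperLim q A :=
  limsup_congr (weighted_adjoint_comp_self q A)

theorem lowerLim_adjoint_comp_self (q : ℝ) (A : E →L[ℂ] F) :
    lowerLim (q / 2) (A.adjoint ∘L A) = lowerLim q A :=
  liminf_congr (weighted_adjoint_comp_self q A)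

theorem upperLim_adjoint (q : ℝ) (A : E →L[ℂ] F) : upperLim q A.adjoint = upperLim q A := by
  rw [upperLim, upperLim, funext (approxNumber_adjoint A)]

theorem lowerLim_adjoint (q : ℝ) (A : E →L[ℂ] F) : lowerLim q A.adjoint = lowerLim q A := by
  rw [lowerLim, lowerLim, funext (approxNumber_adjoint A)]

theorem upperLim_comp_adjoint_self (q : ℝ) (A : E →L[ℂ] F) :
    upperLim (q / 2) (A ∘L A.adjoint) = upperLim q A := by
  have h := upperLim_adjoint_comp_self q A.adjoint
  rwa [ContinuousLinearMap.adjoint_adjoint, upperLim_adjoint] at h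

theorem lowerLim_comp_adjoint_self (q : ℝ) (A : E →L[ℂ] F) :
    lowerLim (q / 2) (A ∘L A.adjoint) = lowerLim q A := by
  have h := lowerLim_adjoint_comp_self q A.adjoint
  rwa [ContinuousLinearMap.adjoint_adjoint, lowerLim_adjoint] at h

end Asymptotics

section AsymptoticOrthogonality

variable {H : Type*} [NormedAddCommGroup H] [InnerProductSpace ℂ H]

theorem upperLim_blockDiag_le {q : ℝ} (hq : 0 < q) (A B : H →L[ℂ] H) :
    upperLim q (blockDiag A B) ≤ upperLim q A + upperLim q B :=
  limsup_weighted_le_add hq (approxNumber_nonneg _) (approxNumber_nonneg _)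
    (approxNumber_nonneg _) fun _ _ hn hm => approxNumber_blockDiag_le A B hn hm

variable [CompleteSpace H]

theorem le_lowerLim_blockDiag {q : ℝ} (hq : 0 < q) (A B : H →L[ℂ] H) :
    lowerLim q A + lowerLim q B ≤ lowerLim q (blockDiag A B) :=
  add_liminf_le_liminf_weighted hq (approxNumber_nonneg _) (approxNumber_nonneg _)
    (approxNumber_nonneg _) (fun _ _ hn h => approxNumber_antitone _ hn h)
    (fun _ hn => le_approxNumber_blockDiag_left A B hn)
    (fun _ hn => le_approxNumber_blockDiag_right A B hn)
    fun _ _ h => le_approxNumber_blockDiag A B h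

theorem adjoint_comp_self_add (A B : H →L[ℂ] H) :
    (A + B).adjoint ∘L (A + B) = (column A B).adjoint ∘L column A B +
      (A.adjoint ∘L B + B.adjoint ∘L A) := by
  rw [adjoint_column_comp_column, map_add]
  ext x
  simp
  abel

theorem negligible_adjoint_comp_comm {A B : H →L[ℂ] H} (h : Negligible (A.adjoint ∘L B)) :
    Negligible (B.adjoint ∘L A) := by
  simpa [ContinuousLinearMap.adjoint_comp] using h.adjoint

theorem negligible_offDiag {A B : H →L[ℂ] H} (h : Negligible (A ∘L B.adjoint)) :
    Negligible (column (ContinuousLinearMap.id ℂ H) 0 ∘L (A ∘L B.adjoint) ∘L projSnd +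
      column 0 (ContinuousLinearMap.id ℂ H) ∘L (B ∘L A.adjoint) ∘L projFst) := by
  have h' : Negligible (B ∘L A.adjoint) := by
    simpa [ContinuousLinearMap.adjoint_comp] using h.adjoint
  exact ((h.comp_right _).comp_left _).add ((h'.comp_right _).comp_left _)

variable {A B : H →L[ℂ] H}

theorem upperLim_add_eq_blockDiag (h₁ : Negligible (A.adjoint ∘L B))
    (h₂ : Negligible (A ∘L B.adjoint)) {q : ℝ} (hq : 0 < q) :
    upperLim q (A + B) = upperLim (q / 2) (blockDiag (A ∘L A.adjoint) (B ∘L B.adjoint)) := by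
  have hq2 : 0 < q / 2 := by positivity
  rw [← upperLim_adjoint_comp_self, adjoint_comp_self_add, upperLim_add_negligible hq2 _
    (h₁.add (negligible_adjoint_comp_comm h₁)), upperLim_adjoint_comp_self,
    ← upperLim_comp_adjoint_self, column_comp_adjoint_column,
    upperLim_add_negligible hq2 _ (negligible_offDiag h₂)]

theorem lowerLim_add_eq_blockDiag (h₁ : Negligible (A.adjoint ∘L B))
    (h₂ : Negligible (A ∘L B.adjoint)) {q : ℝ} (hq : 0 < q) :
    lowerLim q (A + B) = lowerLim (q / 2) (blockDiag (A ∘L A.adjoint) (B ∘L B.adjoint)) := by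
  have hq2 : 0 < q / 2 := by positivity
  rw [← lowerLim_adjoint_comp_self, adjoint_comp_self_add, lowerLim_add_negligible hq2 _
    (h₁.add (negligible_adjoint_comp_comm h₁)), lowerLim_adjoint_comp_self,
    ← lowerLim_comp_adjoint_self, column_comp_adjoint_column,
    lowerLim_add_negligible hq2 _ (negligible_offDiag h₂)]

/-- Asymptotically orthogonal operators: the upper limits are subadditive. -/
theorem upperLim_add_le_of_orthogonal (h₁ : Negligible (A.adjoint ∘L B))
    (h₂ : Negligible (A ∘L B.adjoint)) {q : ℝ} (hq : 0 < q) :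
    upperLim q (A + B) ≤ upperLim q A + upperLim q B := by
  rw [upperLim_add_eq_blockDiag h₁ h₂ hq, ← upperLim_comp_adjoint_self q A,
    ← upperLim_comp_adjoint_self q B]
  exact upperLim_blockDiag_le (by positivity) _ _

/-- Asymptotically orthogonal operators: the lower limits are superadditive. -/
theorem le_lowerLim_add_of_orthogonal (h₁ : Negligible (A.adjoint ∘L B))
    (h₂ : Negligible (A ∘L B.adjoint)) {q : ℝ} (hq : 0 < q) :
    lowerLim q A + lowerLim q B ≤ lowerLim q (A + B) := by
  rw [lowerLim_add_eq_blockDiag h₁ h₂ hq, ← lowerLim_comp_adjoint_self q A,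
    ← lowerLim_comp_adjoint_self q B]
  exact le_lowerLim_blockDiag (by positivity) _ _

end AsymptoticOrthogonality

section Multiplication

theorem mulOp_coeFn (a : LinftyR) (f : L2R) : mulOp a f =ᵐ[volume] fun x => a x * f x :=
  (ContinuousLinearMap.mul ℂ ℂ).coeFn_holder a f

/-- The product of two bounded symbols. -/
def symbolMul (a b : LinftyR) : LinftyR := (ContinuousLinearMap.mul ℂ ℂ).holder ∞ a b

theorem symbolMul_coeFn (a b : LinftyR) : symbolMul a b =ᵐ[volume] fun x => a x * b x :=
  (ContinuousLinearMap.mul ℂ ℂ).coeFn_holder a b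

theorem mulOp_add (a b : LinftyR) : mulOp (a + b) = mulOp a + mulOp b := by
  simp [mulOp]

theorem mulOp_symbolMul (a b : LinftyR) : mulOp (symbolMul a b) = mulOp a ∘L mulOp b := by
  refine ContinuousLinearMap.ext fun f => Lp.ext ?_
  filter_upwards [mulOp_coeFn (symbolMul a b) f, symbolMul_coeFn a b, mulOp_coeFn b f,
    mulOp_coeFn a (mulOp b f)] with x h1 h2 h3 h4
  rw [h1, h2, ContinuousLinearMap.comp_apply, h4, h3, mul_assoc]

theorem mulOp_comm (a b : LinftyR) : mulOp a ∘L mulOp b = mulOp b ∘L mulOp a := by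
  refine ContinuousLinearMap.ext fun f => Lp.ext ?_
  filter_upwards [mulOp_coeFn a f, mulOp_coeFn b f, mulOp_coeFn b (mulOp a f),
    mulOp_coeFn a (mulOp b f)] with x h1 h2 h3 h4
  rw [ContinuousLinearMap.comp_apply, ContinuousLinearMap.comp_apply, h4, h3, h1, h2]
  ring

theorem adjoint_mulOp (a : LinftyR) : (mulOp a).adjoint = mulOp (star a) := by
  symm
  rw [ContinuousLinearMap.eq_adjoint_iff]
  intro f g
  rw [L2.inner_def, L2.inner_def]
  refine integral_congr_ae ?_
  filter_upwards [mulOp_coeFn (star a) f, mulOp_coeFn a g, Lp.coeFn_star a] with x h1 h2 h3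
  rw [h1, h2, h3]
  simp [mul_assoc, mul_comm, mul_left_comm]

theorem mulOp_congr_coeFn {a : LinftyR} {φ : ℝ → ℂ} (h : a =ᵐ[volume] φ) (f : L2R) :
    mulOp a f =ᵐ[volume] fun x => φ x * f x := by
  filter_upwards [mulOp_coeFn a f, h] with x h1 h2
  rw [h1, h2]

/-- A bounded measurable function as a symbol. -/
def boundedSymbol (φ : ℝ → ℂ) (hφ : Measurable φ) {C : ℝ} (hC : ∀ x, ‖φ x‖ ≤ C) : LinftyR :=
  (memLp_top_of_bound hφ.aestronglyMeasurable C (ae_of_all _ hC)).toLp φ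

theorem boundedSymbol_coeFn {φ : ℝ → ℂ} (hφ : Measurable φ) {C : ℝ} (hC : ∀ x, ‖φ x‖ ≤ C) :
    boundedSymbol φ hφ hC =ᵐ[volume] φ := MemLp.coeFn_toLp _

theorem norm_mulOp_le {a : LinftyR} {C : ℝ} (hC : 0 ≤ C) (h : ∀ᵐ x, ‖a x‖ ≤ C) :
    ‖mulOp a‖ ≤ C := by
  refine ContinuousLinearMap.opNorm_le_bound _ hC fun f => ?_
  refine Lp.norm_le_mul_norm_of_ae_le_mul ?_
  filter_upwards [mulOp_coeFn a f, h] with x h1 h2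
  rw [h1, norm_mul]
  gcongr

/-- Multiplication by the indicator function of `s`. -/
def restrictOp (s : Set ℝ) (hs : MeasurableSet s) : L2R →L[ℂ] L2R :=
  mulOp (boundedSymbol (s.indicator 1) (measurable_one.indicator hs) (C := 1) fun x => by
    by_cases h : x ∈ s <;> simp [h])

theorem restrictOp_coeFn {s : Set ℝ} (hs : MeasurableSet s) (f : L2R) :
    restrictOp s hs f =ᵐ[volume] fun x => s.indicator 1 x * f x :=
  mulOp_congr_coeFn (boundedSymbol_coeFn _ _) f

theorem restrictOp_eq_zero_iff {s : Set ℝ} (hs : MeasurableSet s) (f : L2R) :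
    restrictOp s hs f = 0 ↔ ∀ᵐ x, x ∈ s → f x = 0 := by
  rw [Lp.eq_zero_iff_ae_eq_zero]
  constructor
  · intro h
    filter_upwards [h, restrictOp_coeFn hs f] with x h1 h2 hx
    rw [h2] at h1
    simpa [hx] using h1
  · intro h
    filter_upwards [h, restrictOp_coeFn hs f] with x h1 h2
    rw [h2]
    by_cases hx : x ∈ s
    · simp [h1 hx]
    · simp [hx]

end Multiplication

section Projection

/-- The Fourier transform as a unitary operator of `L²(ℝ)`. -/
abbrev fourierL2 : L2R ≃ₗᵢ[ℂ] L2R := Lp.fourierTransformₗᵢ ℝ ℂ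

/-- The orthogonal projection onto the Hardy space, as an operator of `L²(ℝ)`. -/
abbrev hardyProj : L2R →L[ℂ] L2R := hardy.starProjection

theorem mem_hardy_iff (u : L2R) : u ∈ hardy ↔ ∀ᵐ t : ℝ, t < 0 → fourierL2 u t = 0 := Iff.rfl

theorem fourierL2_hardyProj (u : L2R) :
    fourierL2 (hardyProj u) = restrictOp (Ici 0) measurableSet_Ici (fourierL2 u) := by
  rw [← LinearIsometryEquiv.eq_symm_apply]
  refine Submodule.eq_starProjection_of_mem_of_inner_eq_zero ?_ fun w hw => ?_
  · rw [mem_hardy_iff, LinearIsometryEquiv.apply_symm_apply]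
    filter_upwards [restrictOp_coeFn measurableSet_Ici (fourierL2 u)] with t h1 h2
    rw [h1]
    simp [h2]
  · rw [← fourierL2.inner_map_map, map_sub, LinearIsometryEquiv.apply_symm_apply, L2.inner_def]
    refine integral_eq_zero_of_ae ?_
    filter_upwards [restrictOp_coeFn measurableSet_Ici (fourierL2 u), (mem_hardy_iff w).1 hw,
      Lp.coeFn_sub (fourierL2 u) (restrictOp (Ici 0) measurableSet_Ici (fourierL2 u))]
      with t h1 h2 h3
    rw [h3, Pi.sub_apply, h1]
    rcases lt_or_ge t 0 with h | h
    · simp [h2 h]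
    · simp [h]

theorem reflection_coeFn (f : L2R) : reflection f =ᵐ[volume] fun x => f (-x) :=
  Lp.coeFn_compMeasurePreserving f (Measure.measurePreserving_neg volume)

theorem reflection_reflection (f : L2R) : reflection (reflection f) = f := by
  refine Lp.ext ?_
  have h := (Measure.measurePreserving_neg (volume : Measure ℝ)).quasiMeasurePreserving.ae
    (reflection_coeFn f)
  filter_upwards [reflection_coeFn (reflection f), h] with x h1 h2
  rw [h1, h2, neg_neg]

theorem adjoint_reflection : reflection.adjoint = reflection := by
  symm
  rw [ContinuousLinearMap.eq_adjoint_iff]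
  intro f g
  have h : inner ℂ (reflection f) (reflection (reflection g)) = inner ℂ f (reflection g) :=
    (Lp.compMeasurePreservingₗᵢ ℂ (fun x : ℝ => -x)
      (Measure.measurePreserving_neg volume)).inner_map_map f (reflection g)
  rwa [reflection_reflection] at h

theorem reflection_toLp (f : SchwartzMap ℝ ℂ) : reflection (f.toLp 2) =
    (SchwartzMap.compCLMOfContinuousLinearEquiv ℂ (ContinuousLinearEquiv.neg ℝ) f).toLp 2 := by
  refine Lp.ext ?_
  have h := (Measure.measurePreserving_neg (volume : Measure ℝ)).quasiMeasurePreserving.ae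
    (f.coeFn_toLp 2 volume)
  filter_upwards [reflection_coeFn (f.toLp 2), h, (SchwartzMap.compCLMOfContinuousLinearEquiv ℂ
    (ContinuousLinearEquiv.neg ℝ) f).coeFn_toLp 2 volume] with x h1 h2 h3
  rw [h1, h2, h3]
  rfl

theorem fourierL2_reflection (u : L2R) : fourierL2 (reflection u) = reflection (fourierL2 u) := by
  have hd := SchwartzMap.denseRange_toLpCLM (E := ℝ) (F := ℂ) (p := 2) (by norm_num)
    (μ := volume)
  refine congrFun (hd.equalizer (g := fun u => fourierL2 (reflection u))
    (h := fun u => reflection (fourierL2 u)) (by fun_prop) (by fun_prop) ?_) u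
  ext1 f
  change 𝓕 (reflection (f.toLp 2)) = reflection (𝓕 (f.toLp 2))
  rw [reflection_toLp, SchwartzMap.toLp_fourier_eq, SchwartzMap.toLp_fourier_eq, reflection_toLp]
  congr 1
  ext x
  change (𝓕 (SchwartzMap.compCLMOfContinuousLinearEquiv ℂ (ContinuousLinearEquiv.neg ℝ) f)) x =
    (𝓕 f) (-x)
  rw [SchwartzMap.fourier_coe, SchwartzMap.fourier_coe, ← Real.fourierInv_eq_fourier_neg,
    Real.fourierInv_eq_fourier_comp_neg]
  rfl

theorem reflection_hardyProj_reflection (u : L2R) :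
    reflection (hardyProj (reflection u)) = u - hardyProj u := by
  apply fourierL2.injective
  rw [fourierL2_reflection, fourierL2_hardyProj, fourierL2_reflection, map_sub, fourierL2_hardyProj]
  set v := fourierL2 u
  refine Lp.ext ?_
  have hq := (Measure.measurePreserving_neg (volume : Measure ℝ)).quasiMeasurePreserving
  have hne : ∀ᵐ x : ℝ, x ≠ 0 := by simp [ae_iff]
  filter_upwards [reflection_coeFn (restrictOp (Ici 0) measurableSet_Ici (reflection v)),
    hq.ae (restrictOp_coeFn measurableSet_Ici (reflection v)), hq.ae (reflection_coeFn v),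
    Lp.coeFn_sub v (restrictOp (Ici 0) measurableSet_Ici v),
    restrictOp_coeFn measurableSet_Ici v, hne] with x h1 h2 h3 h4 h5 h6
  rw [h1, h2, h3, h4, Pi.sub_apply, h5, neg_neg]
  rcases lt_or_gt_of_ne h6 with h | h
  · simp [h, h.le]
  · simp [h.le, h]

theorem hardyProj_reflection_hardyProj (u : L2R) : hardyProj (reflection (hardyProj u)) = 0 := by
  have h := reflection_hardyProj_reflection (reflection (hardyProj u))
  rw [reflection_reflection] at h
  have h2 : hardyProj (hardyProj u) = hardyProj u :=
    Submodule.starProjection_eq_self_iff.2 (Submodule.starProjection_apply_mem _ _)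
  rw [h2, eq_comm, sub_eq_self] at h
  exact h

end Projection

section Resolvent

theorem one_sub_I_mul_ne_zero (x : ℝ) : (1 : ℂ) - Complex.I * x ≠ 0 := by
  intro h
  have := congrArg Complex.re h
  simp at this

/-- The function `1 / (1 - i x)`. -/
def resolventFun (x : ℝ) : ℂ := (1 - Complex.I * x)⁻¹

theorem resolventFun_hasTemperateGrowth : Function.HasTemperateGrowth resolventFun := by
  have h1 : resolventFun = fun x : ℝ =>
      ((1 : ℂ) + Complex.I * (x : ℂ)) * (((1 + ‖x‖ ^ 2) ^ (-1 : ℝ) : ℝ) : ℂ) := by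
    ext x
    have h := one_sub_I_mul_ne_zero x
    have h2 : (1 : ℂ) + (x : ℂ) ^ 2 ≠ 0 := by
      have : (0 : ℝ) < 1 + x ^ 2 := by positivity
      exact_mod_cast this.ne'
    rw [Real.rpow_neg_one, resolventFun]
    push_cast
    rw [Real.norm_eq_abs, ← Complex.ofReal_pow, sq_abs]
    push_cast
    field_simp
    ring_nf
    simp [Complex.I_sq]
  rw [h1]
  have h2 := (Function.hasTemperateGrowth_one_add_norm_sq_rpow ℝ (-1))
  have h3 := Function.Complex.hasTemperateGrowth_ofReal.comp h2
  have h4 : Function.HasTemperateGrowth fun x : ℝ => (1 : ℂ) + Complex.I * (x : ℂ) :=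
    (Function.HasTemperateGrowth.const _).add
      ((Function.HasTemperateGrowth.const _).mul Function.Complex.hasTemperateGrowth_ofReal)
  exact h4.mul h3

theorem continuous_resolventFun : Continuous resolventFun := by
  unfold resolventFun
  exact (by fun_prop : Continuous fun x : ℝ => (1 : ℂ) - Complex.I * x).inv₀ one_sub_I_mul_ne_zero

theorem norm_resolventFun_le (x : ℝ) : ‖resolventFun x‖ ≤ 1 := by
  rw [resolventFun, norm_inv]
  refine inv_le_one_of_one_le₀ ?_
  calc (1 : ℝ) = |((1 : ℂ) - Complex.I * x).re| := by simp
    _ ≤ _ := Complex.abs_re_le_norm _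

/-- Multiplication by `1 / (1 - i x)`. -/
def resolventOp : L2R →L[ℂ] L2R :=
  mulOp (boundedSymbol resolventFun continuous_resolventFun.measurable norm_resolventFun_le)

theorem resolventOp_coeFn (f : L2R) :
    resolventOp f =ᵐ[volume] fun x => resolventFun x * f x :=
  mulOp_congr_coeFn (boundedSymbol_coeFn _ _) f

/-- On Schwartz functions the resolvent solves the equation `G' + 2πG = 2πg` on the Fourier side. -/
theorem exists_resolvent_schwartz (g : SchwartzMap ℝ ℂ) : ∃ G : SchwartzMap ℝ ℂ,
    fourierL2 (resolventOp (fourierL2.symm (g.toLp 2))) = G.toLp 2 ∧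
      ∀ t, HasDerivAt G (2 * Real.pi * (g t - G t)) t := by
  set h : SchwartzMap ℝ ℂ := SchwartzMap.smulLeftCLM ℂ resolventFun (𝓕⁻ g) with hh
  have hval : ∀ x, h x = resolventFun x * (𝓕⁻ g : SchwartzMap ℝ ℂ) x := fun x => by
    rw [hh, SchwartzMap.smulLeftCLM_apply_apply resolventFun_hasTemperateGrowth, smul_eq_mul]
  refine ⟨𝓕 h, ?_, fun t => ?_⟩
  · have h1 : fourierL2.symm (g.toLp 2) = (𝓕⁻ g : SchwartzMap ℝ ℂ).toLp 2 :=
      SchwartzMap.toLp_fourierInv_eq g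
    have h2 : resolventOp ((𝓕⁻ g : SchwartzMap ℝ ℂ).toLp 2) = h.toLp 2 := by
      refine Lp.ext ?_
      filter_upwards [resolventOp_coeFn ((𝓕⁻ g : SchwartzMap ℝ ℂ).toLp 2),
        (𝓕⁻ g : SchwartzMap ℝ ℂ).coeFn_toLp 2 volume, h.coeFn_toLp 2 volume] with x h1 h2 h3
      rw [h1, h2, h3, hval]
    rw [h1, h2]
    exact SchwartzMap.toLp_fourier_eq h
  · have hG : HasDerivAt (𝓕 h : SchwartzMap ℝ ℂ) (deriv (𝓕 h : SchwartzMap ℝ ℂ) t) t :=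
      ((𝓕 h : SchwartzMap ℝ ℂ).differentiable t).hasDerivAt
    convert hG using 1
    have hxint : Integrable (fun x : ℝ => x • h x) volume := by
      have := (SchwartzMap.smulLeftCLM ℂ (fun x : ℝ => x) h).integrable (μ := volume)
      refine this.congr (ae_of_all _ fun x => ?_)
      rw [SchwartzMap.smulLeftCLM_apply_apply Function.HasTemperateGrowth.id']
    set xh : SchwartzMap ℝ ℂ := SchwartzMap.smulLeftCLM ℂ (fun x : ℝ => (x : ℂ)) h with hxh
    have hxval : ∀ x, xh x = (x : ℂ) * h x := fun x => by
      rw [hxh, SchwartzMap.smulLeftCLM_apply_apply Function.Complex.hasTemperateGrowth_ofReal,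
        smul_eq_mul]
    have hdec : (𝓕⁻ g : SchwartzMap ℝ ℂ) = h + (-Complex.I) • xh := by
      ext x
      have := one_sub_I_mul_ne_zero x
      rw [add_apply, smul_apply, hxval, hval, resolventFun, smul_eq_mul]
      field_simp
      ring
    have hg : g = 𝓕 h + (-Complex.I) • 𝓕 xh := by
      rw [← FourierTransform.fourier_smul, ← FourierTransform.fourier_add, ← hdec]
      exact (FourierTransform.fourier_fourierInv_eq g).symm
    have hder : (fun x : ℝ => (-2 * (Real.pi : ℂ) * Complex.I * x) • h x) =
        ((-2 * (Real.pi : ℂ) * Complex.I) • xh : SchwartzMap ℝ ℂ) := by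
      ext x
      rw [smul_apply, hxval, smul_eq_mul, smul_eq_mul, mul_assoc]
    have hgt : g t = (𝓕 h : SchwartzMap ℝ ℂ) t + -Complex.I * (𝓕 xh : SchwartzMap ℝ ℂ) t := by
      conv_lhs => rw [hg]
      rfl
    rw [hgt, SchwartzMap.fourier_coe, Real.deriv_fourier h.integrable hxint, hder,
      ← SchwartzMap.fourier_coe ((-2 * (Real.pi : ℂ) * Complex.I) • xh),
      FourierTransform.fourier_smul, smul_apply, ← SchwartzMap.fourier_coe h, smul_eq_mul]
    ring

theorem mul_exp_eq_of_ode {g G : ℝ → ℂ}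
    (hG : ∀ t, HasDerivAt G (2 * Real.pi * (g t - G t)) t) {a b : ℝ} (hab : a ≤ b)
    (hg : ∀ t ∈ Ico a b, g t = 0) :
    G b * Complex.exp (2 * Real.pi * b) = G a * Complex.exp (2 * Real.pi * a) := by
  have hexp : ∀ t : ℝ, HasDerivAt (fun t : ℝ => Complex.exp (2 * Real.pi * t))
      (Complex.exp (2 * Real.pi * t) * (2 * Real.pi)) t := fun t => by
    have h1 : HasDerivAt (fun t : ℝ => 2 * (Real.pi : ℂ) * t) (2 * Real.pi) t := by
      simpa using (Complex.ofRealCLM.hasDerivAt (x := t)).const_mul (2 * (Real.pi : ℂ))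
    exact h1.cexp
  have hd : ∀ t, HasDerivAt (fun t : ℝ => G t * Complex.exp (2 * Real.pi * t))
      (2 * Real.pi * g t * Complex.exp (2 * Real.pi * t)) t := fun t => by
    refine ((hG t).mul (hexp t)).congr_deriv ?_
    ring
  refine constant_of_has_deriv_right_zero (f := fun t : ℝ => G t * Complex.exp (2 * Real.pi * t))
    (fun t _ => (hd t).continuousAt.continuousWithinAt) (fun t ht => ?_) b (right_mem_Icc.2 hab)
  have := (hd t).hasDerivWithinAt (s := Ici t)
  simpa [hg t ht] using this

theorem eq_zero_of_ode {g G : ℝ → ℂ} (hG : ∀ t, HasDerivAt G (2 * Real.pi * (g t - G t)) t)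
    {C : ℝ} (hC : ∀ t, ‖G t‖ ≤ C) (hg : ∀ t ≤ 0, g t = 0) {t : ℝ} (ht : t ≤ 0) : G t = 0 := by
  have h1 : ∀ᶠ s in atBot, ‖G t * Complex.exp (2 * Real.pi * t)‖ ≤
      C * Real.exp (2 * Real.pi * s) := by
    filter_upwards [eventually_le_atBot t] with s hs
    rw [mul_exp_eq_of_ode hG hs fun r hr => hg r (hr.2.le.trans ht), norm_mul, Complex.norm_exp]
    have h3 : (2 * (Real.pi : ℂ) * s).re = 2 * Real.pi * s := by simp
    rw [h3]
    gcongr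
    exact hC s
  have h2 : Tendsto (fun s : ℝ => C * Real.exp (2 * Real.pi * s)) atBot (nhds 0) := by
    have := (Real.tendsto_exp_atBot.comp
      ((tendsto_id (α := ℝ)).const_mul_atBot Real.two_pi_pos)).const_mul C
    simpa using this
  have h3 : G t * Complex.exp (2 * Real.pi * t) = 0 :=
    norm_le_zero_iff.1 (ge_of_tendsto h2 h1)
  simpa using h3

theorem eq_exp_of_ode {g G : ℝ → ℂ} (hG : ∀ t, HasDerivAt G (2 * Real.pi * (g t - G t)) t)
    (hg : ∀ t ≥ 0, g t = 0) {t : ℝ} (ht : 0 ≤ t) :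
    G t = G 0 * Complex.exp (-(2 * Real.pi * t)) := by
  have h := mul_exp_eq_of_ode hG ht fun r hr => hg r hr.1
  rw [Complex.exp_neg, ← div_eq_mul_inv, eq_div_iff (Complex.exp_ne_zero _), h]
  simp

theorem mem_of_forall_schwartz {U : Set ℝ} (hU : IsOpen U) {K : Submodule ℂ L2R}
    (hK : IsClosed (K : Set L2R))
    (h : ∀ g : SchwartzMap ℝ ℂ, (∀ t ∉ U, g t = 0) → g.toLp 2 volume ∈ K) {u : L2R}
    (hu : ∀ᵐ t, t ∉ U → u t = 0) : u ∈ K := by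
  have : CompleteSpace K := hK.completeSpace_coe
  rw [← K.orthogonal_orthogonal]
  intro w hw
  have hw0 : ∀ᵐ t, t ∈ U → w t = 0 := by
    refine hU.ae_eq_zero_of_integral_contDiff_smul_eq_zero
      (((Lp.memLp w).locallyIntegrable one_le_two).locallyIntegrableOn U) fun g hg hgc hgU => ?_
    have hgc' : HasCompactSupport fun t => (g t : ℂ) :=
      hgc.comp_left (g := fun r : ℝ => (r : ℂ)) Complex.ofReal_zero
    have hg' : ContDiff ℝ ((⊤ : ℕ∞) : WithTop ℕ∞) fun t => (g t : ℂ) :=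
      Complex.ofRealCLM.contDiff.comp hg
    have h1 := hw _ (h (hgc'.toSchwartzMap hg') fun t ht => by
      have : g t = 0 := image_eq_zero_of_notMem_tsupport fun hm => ht (hgU hm)
      simp [this])
    rw [L2.inner_def] at h1
    rw [← h1]
    refine integral_congr_ae ?_
    filter_upwards [(hgc'.toSchwartzMap hg').coeFn_toLp 2 volume] with t ht
    rw [ht]
    simp [mul_comm]
  rw [L2.inner_def]
  refine integral_eq_zero_of_ae ?_
  filter_upwards [hw0, hu] with t h1 h2
  by_cases ht : t ∈ U
  · simp [h1 ht]
  · simp [h2 ht]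

/-- The resolvent on the Fourier side. -/
def resolventFourier : L2R →L[ℂ] L2R :=
  fourierL2.toContinuousLinearEquiv.toContinuousLinearMap ∘L resolventOp ∘L
    fourierL2.symm.toContinuousLinearEquiv.toContinuousLinearMap

theorem resolventFourier_apply (u : L2R) :
    resolventFourier u = fourierL2 (resolventOp (fourierL2.symm u)) := rfl

theorem restrict_resolventFourier_eq_zero {u : L2R} (hu : ∀ᵐ t : ℝ, t ∉ Ioi 0 → u t = 0) :
    restrictOp (Iio 0) measurableSet_Iio (resolventFourier u) = 0 := by
  let X := restrictOp (Iio 0) measurableSet_Iio ∘L resolventFourier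
  suffices h : u ∈ X.ker from LinearMap.mem_ker.1 h
  refine mem_of_forall_schwartz isOpen_Ioi X.isClosed_ker (fun g hg => ?_) hu
  obtain ⟨G, hG1, hG2⟩ := exists_resolvent_schwartz g
  have h1 : X (g.toLp 2) = restrictOp (Iio 0) measurableSet_Iio (G.toLp 2) := by
    rw [← hG1]; rfl
  refine LinearMap.mem_ker.2 (h1.trans ?_)
  rw [restrictOp_eq_zero_iff]
  filter_upwards [G.coeFn_toLp 2 volume] with t ht1 ht2
  rw [ht1]
  exact eq_zero_of_ode hG2 (fun t => SchwartzMap.norm_le_seminorm ℝ G t)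
    (fun t ht => hg t (not_lt.2 ht)) (le_of_lt ht2)

theorem memLp_halfLine_exp :
    MemLp ((Ici (0 : ℝ)).indicator fun t => Complex.exp (-(2 * Real.pi * t))) 2 volume := by
  rw [memLp_indicator_iff_restrict measurableSet_Ici,
    memLp_two_iff_integrable_sq_norm (by fun_prop)]
  have h1 : IntegrableOn (fun t : ℝ => Real.exp (-(4 * Real.pi) * t)) (Ici 0) :=
    (integrableOn_Ici_iff_integrableOn_Ioi).2 (exp_neg_integrableOn_Ioi 0 (by positivity))
  refine h1.congr (ae_of_all _ fun t => ?_)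
  have h2 : (-(2 * (Real.pi : ℂ) * t)).re = -(2 * Real.pi * t) := by simp
  simp only [Complex.norm_exp, h2]
  rw [← Real.exp_nat_mul]
  congr 1
  push_cast
  ring

/-- The function `exp (-2πt)` on the half-line. -/
def halfLineExp : L2R := memLp_halfLine_exp.toLp _

theorem halfLineExp_coeFn : halfLineExp =ᵐ[volume]
    (Ici (0 : ℝ)).indicator fun t => Complex.exp (-(2 * Real.pi * t)) :=
  memLp_halfLine_exp.coeFn_toLp

theorem restrict_resolventFourier_mem_span {u : L2R} (hu : ∀ᵐ t : ℝ, t ∉ Iio 0 → u t = 0) :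
    restrictOp (Ici 0) measurableSet_Ici (resolventFourier u) ∈
      Submodule.span ℂ {halfLineExp} := by
  obtain ⟨X, hX⟩ : ∃ X : L2R →L[ℂ] L2R, ∀ v,
      X v = restrictOp (Ici 0) measurableSet_Ici (resolventFourier v) :=
    ⟨restrictOp (Ici 0) measurableSet_Ici ∘L resolventFourier, fun _ => rfl⟩
  rw [← hX]
  have hS : IsClosed (Submodule.span ℂ {halfLineExp} : Set L2R) :=
    Submodule.closed_of_finiteDimensional _
  suffices h : u ∈ (Submodule.span ℂ {halfLineExp}).comap X.toLinearMap from
    Submodule.mem_comap.1 h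
  refine mem_of_forall_schwartz isOpen_Iio (hS.preimage X.continuous) (fun g hg => ?_) hu
  obtain ⟨G, hG1, hG2⟩ := exists_resolvent_schwartz g
  have h1 : X (g.toLp 2) = restrictOp (Ici 0) measurableSet_Ici (G.toLp 2) := by
    rw [hX, resolventFourier_apply, hG1]
  rw [Submodule.mem_comap, ContinuousLinearMap.coe_coe, h1, Submodule.mem_span_singleton]
  refine ⟨G 0, Lp.ext ?_⟩
  filter_upwards [G.coeFn_toLp 2 volume, restrictOp_coeFn measurableSet_Ici (G.toLp 2),
    Lp.coeFn_smul (G 0) halfLineExp, halfLineExp_coeFn] with t h1 h2 h3 h4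
  rw [h2, h1, h3, Pi.smul_apply, h4]
  by_cases ht : t ∈ Ici (0 : ℝ)
  · rw [indicator_of_mem ht, indicator_of_mem ht,
      eq_exp_of_ode hG2 (fun t ht => hg t (not_lt.2 ht)) ht]
    simp
  · simp [ht]

end Resolvent

section Commutator

theorem approxBound_zero_of_range_le {E F : Type*} [NormedAddCommGroup E] [InnerProductSpace ℂ E]
    [NormedAddCommGroup F] [InnerProductSpace ℂ F] [CompleteSpace E] [CompleteSpace F]
    {X : E →L[ℂ] F} {V : Submodule ℂ F} {n : ℕ} (hV : Module.rank ℂ V < n)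
    (h : ∀ x, X x ∈ V) : ApproxBound X n 0 := by
  have h1 : ApproxBound X.adjoint n 0 := by
    refine ⟨V, hV, fun y hy => ?_⟩
    have : X.adjoint y = 0 := by
      refine ext_inner_left ℂ fun x => ?_
      rw [ContinuousLinearMap.adjoint_inner_right, inner_zero_right]
      exact hy _ (h x)
    simp [this]
  simpa using h1.adjoint le_rfl

/-- The commutator with the Hardy projection. -/
def commProj (X : L2R →L[ℂ] L2R) : L2R →L[ℂ] L2R := hardyProj ∘L X - X ∘L hardyProj

theorem commProj_apply (X : L2R →L[ℂ] L2R) (u : L2R) :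
    commProj X u = hardyProj (X u) - X (hardyProj u) := rfl

theorem commProj_add (X Y : L2R →L[ℂ] L2R) : commProj (X + Y) = commProj X + commProj Y := by
  ext1 u
  simp [commProj_apply]
  abel

theorem commProj_smul (c : ℂ) (X : L2R →L[ℂ] L2R) : commProj (c • X) = c • commProj X := by
  ext1 u
  simp [commProj_apply, smul_sub]

theorem commProj_sum {ι : Type*} (s : Finset ι) (X : ι → L2R →L[ℂ] L2R) :
    commProj (∑ i ∈ s, X i) = ∑ i ∈ s, commProj (X i) := by
  classical
  induction s using Finset.induction_on with
  | empty => ext1 u; simp [commProj_apply]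
  | insert a s ha ih => rw [Finset.sum_insert ha, Finset.sum_insert ha, commProj_add, ih]

theorem commProj_one : commProj 1 = 0 := by
  ext1 u
  simp [commProj_apply]

theorem commProj_comp (X Y : L2R →L[ℂ] L2R) :
    commProj (X ∘L Y) = commProj X ∘L Y + X ∘L commProj Y := by
  ext1 u
  simp [commProj_apply]

theorem commProj_adjoint (X : L2R →L[ℂ] L2R) : commProj X.adjoint = -(commProj X).adjoint := by
  have h : hardyProj.adjoint = hardyProj := by
    rw [← ContinuousLinearMap.star_eq_adjoint]
    exact (isSelfAdjoint_starProjection hardy).star_eq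
  simp only [commProj, map_sub, ContinuousLinearMap.adjoint_comp, h, neg_sub]

theorem norm_commProj_le (X : L2R →L[ℂ] L2R) : ‖commProj X‖ ≤ 2 * ‖X‖ := by
  have h : ‖hardyProj‖ ≤ 1 := hardy.starProjection_norm_le
  calc ‖commProj X‖ ≤ ‖hardyProj ∘L X‖ + ‖X ∘L hardyProj‖ := norm_sub_le _ _
    _ ≤ ‖hardyProj‖ * ‖X‖ + ‖X‖ * ‖hardyProj‖ :=
        add_le_add (ContinuousLinearMap.opNorm_comp_le _ _) (ContinuousLinearMap.opNorm_comp_le _ _)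
    _ ≤ 1 * ‖X‖ + ‖X‖ * 1 := by gcongr
    _ = _ := by ring

theorem restrictOp_add_restrictOp (v : L2R) :
    restrictOp (Ici 0) measurableSet_Ici v + restrictOp (Iio 0) measurableSet_Iio v = v := by
  refine Lp.ext ?_
  filter_upwards [restrictOp_coeFn measurableSet_Ici v, restrictOp_coeFn measurableSet_Iio v,
    Lp.coeFn_add (restrictOp (Ici 0) measurableSet_Ici v)
      (restrictOp (Iio 0) measurableSet_Iio v)] with x h1 h2 h3
  rw [h3, Pi.add_apply, h1, h2]
  rcases lt_or_ge x 0 with h | h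
  · simp [h]
  · simp [h]

theorem approxBound_commProj_resolventOp : ApproxBound (commProj resolventOp) 2 0 := by
  have hV : Module.rank ℂ (Submodule.span ℂ {fourierL2.symm halfLineExp}) < ((2 : ℕ) : Cardinal) :=
    (rank_span_le _).trans_lt (by simp)
  refine approxBound_zero_of_range_le hV fun u => ?_
  set v := fourierL2 u with hv
  have hne : ∀ᵐ x : ℝ, x ≠ 0 := by simp [ae_iff]
  have h1 := restrict_resolventFourier_eq_zero (u := restrictOp (Ici 0) measurableSet_Ici v) (by
    filter_upwards [restrictOp_coeFn measurableSet_Ici v, hne] with t ht h0 hn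
    have : t ∉ Ici (0 : ℝ) := fun h => hn (lt_of_le_of_ne h (Ne.symm h0))
    rw [ht, indicator_of_notMem this, zero_mul])
  have h2 := restrict_resolventFourier_mem_span (u := restrictOp (Iio 0) measurableSet_Iio v) (by
    filter_upwards [restrictOp_coeFn measurableSet_Iio v] with t ht hn
    rw [ht, indicator_of_notMem hn, zero_mul])
  have h3 : fourierL2 (commProj resolventOp u) = restrictOp (Ici 0) measurableSet_Ici
      (resolventFourier (restrictOp (Iio 0) measurableSet_Iio v)) := by
    have e1 : fourierL2 (resolventOp u) = resolventFourier v := by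
      rw [resolventFourier_apply, hv, LinearIsometryEquiv.symm_apply_apply]
    have e2 : fourierL2 (resolventOp (hardyProj u)) =
        resolventFourier (restrictOp (Ici 0) measurableSet_Ici v) := by
      rw [resolventFourier_apply, ← fourierL2_hardyProj, LinearIsometryEquiv.symm_apply_apply]
    rw [commProj_apply, map_sub, fourierL2_hardyProj, e1, e2]
    have e3 := restrictOp_add_restrictOp
      (resolventFourier (restrictOp (Ici 0) measurableSet_Ici v))
    rw [h1, add_zero] at e3
    conv_lhs => rw [← e3, ← map_sub, ← map_sub]
    congr 2
    nth_rw 1 [← restrictOp_add_restrictOp v]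
    abel
  rw [← h3] at h2
  rw [Submodule.mem_span_singleton] at h2 ⊢
  obtain ⟨c, hc⟩ := h2
  exact ⟨c, by rw [← map_smul, hc, LinearIsometryEquiv.symm_apply_apply]⟩

end Commutator

section Circle

instance factPiPos : Fact (0 < Real.pi) := ⟨Real.pi_pos⟩

/-- Multiplication by a continuous function on the circle `ℝ_*`, parametrized by `arctan`. -/
def circOp (ψ : C(AddCircle Real.pi, ℂ)) : L2R →L[ℂ] L2R :=
  mulOp (boundedSymbol (fun x : ℝ => ψ (Real.arctan x : AddCircle Real.pi))
    (ψ.continuous.comp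
      ((AddCircle.continuous_mk' _).comp Real.continuous_arctan)).measurable
    (fun _ => ψ.norm_coe_le_norm _))

theorem circOp_coeFn (ψ : C(AddCircle Real.pi, ℂ)) (f : L2R) :
    circOp ψ f =ᵐ[volume] fun x => ψ (Real.arctan x : AddCircle Real.pi) * f x :=
  mulOp_congr_coeFn (boundedSymbol_coeFn _ _) f

theorem norm_circOp_le (ψ : C(AddCircle Real.pi, ℂ)) : ‖circOp ψ‖ ≤ ‖ψ‖ := by
  refine norm_mulOp_le (norm_nonneg _) ?_
  filter_upwards [boundedSymbol_coeFn (φ := fun x : ℝ => ψ (Real.arctan x : AddCircle Real.pi))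
    (ψ.continuous.comp
      ((AddCircle.continuous_mk' _).comp Real.continuous_arctan)).measurable
    (fun _ => ψ.norm_coe_le_norm _)] with x hx
  rw [hx]
  exact ψ.norm_coe_le_norm _

theorem circOp_add (ψ φ : C(AddCircle Real.pi, ℂ)) : circOp (ψ + φ) = circOp ψ + circOp φ := by
  refine ContinuousLinearMap.ext fun f => Lp.ext ?_
  filter_upwards [circOp_coeFn (ψ + φ) f, circOp_coeFn ψ f, circOp_coeFn φ f,
    Lp.coeFn_add (circOp ψ f) (circOp φ f)] with x h1 h2 h3 h4
  have e : (circOp ψ + circOp φ) f = circOp ψ f + circOp φ f := rfl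
  rw [e, h1, h4, Pi.add_apply, h2, h3, ContinuousMap.add_apply, add_mul]

theorem circOp_smul (c : ℂ) (ψ : C(AddCircle Real.pi, ℂ)) : circOp (c • ψ) = c • circOp ψ := by
  refine ContinuousLinearMap.ext fun f => Lp.ext ?_
  filter_upwards [circOp_coeFn (c • ψ) f, circOp_coeFn ψ f,
    Lp.coeFn_smul c (circOp ψ f)] with x h1 h2 h4
  have e : (c • circOp ψ) f = c • circOp ψ f := rfl
  rw [e, h1, h4, Pi.smul_apply, h2, ContinuousMap.smul_apply, smul_eq_mul, smul_eq_mul,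
    mul_assoc]

theorem circOp_mul (ψ φ : C(AddCircle Real.pi, ℂ)) : circOp (ψ * φ) = circOp ψ ∘L circOp φ := by
  refine ContinuousLinearMap.ext fun f => Lp.ext ?_
  filter_upwards [circOp_coeFn (ψ * φ) f, circOp_coeFn ψ (circOp φ f), circOp_coeFn φ f]
    with x h1 h2 h3
  rw [h1, ContinuousLinearMap.comp_apply, h2, h3, ContinuousMap.mul_apply, mul_assoc]

theorem circOp_one : circOp 1 = 1 := by
  refine ContinuousLinearMap.ext fun f => Lp.ext ?_
  filter_upwards [circOp_coeFn 1 f] with x h1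
  rw [h1]
  simp

theorem circOp_zero : circOp 0 = 0 := by
  refine ContinuousLinearMap.ext fun f => Lp.ext ?_
  filter_upwards [circOp_coeFn 0 f, Lp.coeFn_zero ℂ 2 (volume : Measure ℝ)] with x h1 h2
  have e : (0 : L2R →L[ℂ] L2R) f = 0 := rfl
  rw [e, h1, h2]
  simp

theorem circOp_sum {ι : Type*} (s : Finset ι) (ψ : ι → C(AddCircle Real.pi, ℂ)) :
    circOp (∑ i ∈ s, ψ i) = ∑ i ∈ s, circOp (ψ i) := by
  classical
  induction s using Finset.induction_on with
  | empty => simp [circOp_zero]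
  | insert a s ha ih => rw [Finset.sum_insert ha, Finset.sum_insert ha, circOp_add, ih]

theorem adjoint_circOp (ψ : C(AddCircle Real.pi, ℂ)) : (circOp ψ).adjoint = circOp (star ψ) := by
  symm
  rw [ContinuousLinearMap.eq_adjoint_iff]
  intro f g
  rw [L2.inner_def, L2.inner_def]
  refine integral_congr_ae ?_
  filter_upwards [circOp_coeFn (star ψ) f, circOp_coeFn ψ g] with x h1 h2
  rw [h1, h2]
  simp [mul_comm, mul_left_comm]

theorem fourier_one_arctan (x : ℝ) :
    fourier 1 (Real.arctan x : AddCircle Real.pi) = 2 * resolventFun x - 1 := by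
  have hpi : (Real.pi : ℂ) ≠ 0 := by exact_mod_cast Real.pi_ne_zero
  set θ := Real.arctan x with hθ
  have hc : Complex.cos θ ≠ 0 := by
    rw [← Complex.ofReal_cos]
    exact_mod_cast (Real.cos_arctan_pos x).ne'
  have hx : (x : ℂ) = Complex.sin θ / Complex.cos θ := by
    rw [← Complex.ofReal_sin, ← Complex.ofReal_cos, ← Complex.ofReal_div, ← Real.tan_eq_sin_div_cos,
      hθ, Real.tan_arctan]
  have h1 : fourier 1 (θ : AddCircle Real.pi) = Complex.exp (θ * Complex.I) *
      Complex.exp (θ * Complex.I) := by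
    rw [fourier_coe_apply, ← Complex.exp_add]
    congr 1
    field_simp
    push_cast
    ring
  have h2 := one_sub_I_mul_ne_zero x
  have h3 : Complex.exp (θ * Complex.I) * Complex.exp (-θ * Complex.I) = 1 := by
    rw [← Complex.exp_add]; simp
  have e1 : Complex.exp (θ * Complex.I) = Complex.cos θ * (1 + Complex.I * x) := by
    rw [Complex.exp_mul_I, hx]; field_simp
  have e2 : Complex.exp (-θ * Complex.I) = Complex.cos θ * (1 - Complex.I * x) := by
    rw [Complex.exp_mul_I, hx, Complex.cos_neg, Complex.sin_neg]; field_simp; ring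
  rw [h1, resolventFun]
  have e3 : Complex.exp (θ * Complex.I) * (1 - Complex.I * x) = (1 + Complex.I * x) *
      Complex.exp (-θ * Complex.I) := by rw [e1, e2]; ring
  have e4 : Complex.exp (θ * Complex.I) * Complex.exp (θ * Complex.I) * (1 - Complex.I * x) =
      1 + Complex.I * x := by
    rw [mul_assoc, e3, mul_left_comm, h3, mul_one]
  rw [eq_div_of_mul_eq h2 e4]
  field_simp
  ring

theorem circOp_fourier_one :
    circOp (fourier 1) = (2 : ℂ) • resolventOp + (-1 : ℂ) • (1 : L2R →L[ℂ] L2R) := by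
  refine ContinuousLinearMap.ext fun f => Lp.ext ?_
  have e : ((2 : ℂ) • resolventOp + (-1 : ℂ) • (1 : L2R →L[ℂ] L2R)) f =
    (2 : ℂ) • resolventOp f + (-1 : ℂ) • f := rfl
  rw [e]
  filter_upwards [circOp_coeFn (fourier 1) f, resolventOp_coeFn f,
    Lp.coeFn_add ((2 : ℂ) • resolventOp f) ((-1 : ℂ) • f),
    Lp.coeFn_smul (2 : ℂ) (resolventOp f), Lp.coeFn_smul (-1 : ℂ) f] with x h1 h2 h3 h4 h5
  rw [h1, fourier_one_arctan, h3, Pi.add_apply, h4, h5, Pi.smul_apply, Pi.smul_apply, h2,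
    smul_eq_mul, smul_eq_mul]
  ring

theorem approxBound_commProj_fourier_natCast (k : ℕ) :
    ApproxBound (commProj (circOp (fourier (k : ℤ)))) (2 * k + 1) 0 := by
  induction k with
  | zero =>
    have : (fourier ((0 : ℕ) : ℤ) : C(AddCircle Real.pi, ℂ)) = 1 := by ext x; simp
    rw [this, circOp_one, commProj_one]
    simpa using approxBound_norm (0 : L2R →L[ℂ] L2R) (le_refl 1)
  | succ k ih =>
    have h1 : (fourier ((k + 1 : ℕ) : ℤ) : C(AddCircle Real.pi, ℂ)) =
        fourier 1 * fourier (k : ℤ) := by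
      ext x
      rw [ContinuousMap.mul_apply, ← fourier_add]
      congr 2
      push_cast
      ring
    have h2 : ApproxBound (commProj (circOp (fourier 1))) 2 0 := by
      rw [circOp_fourier_one, commProj_add, commProj_smul, commProj_smul, commProj_one, smul_zero,
        add_zero]
      have := approxBound_commProj_resolventOp.comp_left
        ((2 : ℂ) • ContinuousLinearMap.id ℂ L2R)
      rw [mul_zero] at this
      exact this
    rw [h1, circOp_mul, commProj_comp]
    have h3 := (h2.comp_right le_rfl (circOp (fourier (k : ℤ)))).add
      (ih.comp_left (circOp (fourier 1)))
    convert h3 using 1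
    · ring
    · simp

theorem approxBound_commProj_fourier (k : ℤ) :
    ApproxBound (commProj (circOp (fourier k))) (2 * k.natAbs + 1) 0 := by
  rcases Int.natAbs_eq k with h | h
  · have h1 := approxBound_commProj_fourier_natCast k.natAbs
    rwa [← h] at h1
  · have h1 : (fourier k : C(AddCircle Real.pi, ℂ)) = star (fourier (k.natAbs : ℤ)) := by
      ext x
      rw [ContinuousMap.star_apply]
      conv_lhs => rw [h, fourier_neg]
      rfl
    rw [h1, ← adjoint_circOp, commProj_adjoint]
    have h2 := ((approxBound_commProj_fourier_natCast k.natAbs).adjoint le_rfl).comp_left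
      (-ContinuousLinearMap.id ℂ L2R)
    rw [mul_zero] at h2
    simpa using h2

theorem approxBound_sum {E F ι : Type*} [NormedAddCommGroup E] [InnerProductSpace ℂ E]
    [NormedAddCommGroup F] [InnerProductSpace ℂ F] (s : Finset ι) {X : ι → E →L[ℂ] F}
    {n : ι → ℕ} (h : ∀ i ∈ s, ApproxBound (X i) (n i) 0) :
    ApproxBound (∑ i ∈ s, X i) (∑ i ∈ s, n i + 1) 0 := by
  classical
  induction s using Finset.induction_on with
  | empty => simpa using approxBound_norm (0 : E →L[ℂ] F) (le_refl 1)
  | insert a s ha ih =>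
    rw [Finset.sum_insert ha, Finset.sum_insert ha, add_assoc]
    simpa using (h a (Finset.mem_insert_self a s)).add
      (ih fun i hi => h i (Finset.mem_insert_of_mem hi))

theorem exists_norm_sub_fourier_sum_le {ψ : C(AddCircle Real.pi, ℂ)}
    (h : ∀ M : ℕ, ∃ C : ℝ, 0 ≤ C ∧ ∀ k : ℤ, k ≠ 0 → ‖fourierCoeff ψ k‖ ≤ C / |(k : ℝ)| ^ M)
    (M : ℕ) : ∃ C : ℝ, 0 ≤ C ∧ ∀ n : ℕ, 1 ≤ n →
      ‖ψ - ∑ k ∈ Finset.Ioo (-(n : ℤ)) n, fourierCoeff ψ k • fourier k‖ ≤ C / (n : ℝ) ^ M := by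
  have hs2 : Summable fun k : ℤ => 1 / (k : ℝ) ^ 2 := Real.summable_one_div_int_pow.2 one_lt_two
  have hsum : Summable (fourierCoeff ψ) := by
    obtain ⟨C, hC0, hC⟩ := h 2
    refine Summable.of_norm_bounded_eventually (hs2.mul_left C) ?_
    filter_upwards [(finite_singleton (0 : ℤ)).compl_mem_cofinite] with k hk
    refine (hC k hk).trans_eq ?_
    rw [sq_abs]
    ring
  have hψ := hasSum_fourier_series_of_summable hsum
  obtain ⟨C, hC0, hC⟩ := h (M + 2)
  refine ⟨C * ∑' k : ℤ, 1 / (k : ℝ) ^ 2, by positivity, fun n hn => ?_⟩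
  set s := Finset.Ioo (-(n : ℤ)) n
  have h1 : HasSum (fun k => if k ∈ s then fourierCoeff ψ k • fourier k else 0)
      (∑ k ∈ s, fourierCoeff ψ k • (fourier k : C(AddCircle Real.pi, ℂ))) := by
    rw [← Finset.sum_congr rfl fun k hk => if_pos hk]
    exact hasSum_sum_of_ne_finset_zero fun k hk => if_neg hk
  have h2 := hψ.sub h1
  have hn0 : (0 : ℝ) < n := by exact_mod_cast hn
  have h3 : HasSum (fun k : ℤ => C / (n : ℝ) ^ M * (1 / (k : ℝ) ^ 2))
      (C / (n : ℝ) ^ M * ∑' k : ℤ, 1 / (k : ℝ) ^ 2) := hs2.hasSum.mul_left _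
  rw [← h2.tsum_eq]
  refine (tsum_of_norm_bounded h3 fun k => ?_).trans_eq (by ring)
  by_cases hk : k ∈ s
  · simp only [hk, if_true, sub_self, norm_zero]
    positivity
  · simp only [hk, if_false, sub_zero]
    have hkn : (n : ℤ) ≤ |k| := by
      by_contra hlt
      exact hk (Finset.mem_Ioo.2 (abs_lt.1 (not_le.1 hlt)))
    have hkn' : (n : ℝ) ≤ |(k : ℝ)| := by exact_mod_cast hkn
    have hk0 : k ≠ 0 := by
      rintro rfl
      simp at hkn
      omega
    rw [norm_smul, fourier_norm, mul_one]
    refine (hC k hk0).trans ?_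
    rw [pow_add, sq_abs, div_mul_div_comm, mul_one]
    have : (0 : ℝ) < (k : ℝ) ^ 2 := by positivity
    gcongr

/-- The commutator of the Hardy projection with multiplication by a smooth function. -/
theorem negligible_commProj {ψ : C(AddCircle Real.pi, ℂ)}
    (h : ∀ M : ℕ, ∃ C : ℝ, 0 ≤ C ∧ ∀ k : ℤ, k ≠ 0 → ‖fourierCoeff ψ k‖ ≤ C / |(k : ℝ)| ^ M) :
    Negligible (commProj (circOp ψ)) := by
  intro M
  obtain ⟨C, hC0, hC⟩ := exists_norm_sub_fourier_sum_le h M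
  obtain ⟨D, hD⟩ := exists_nat_ge (2 * C)
  refine ⟨6 + D, fun n hn => ?_⟩
  set s := Finset.Ioo (-(n : ℤ)) n with hs
  set S : C(AddCircle Real.pi, ℂ) := ∑ k ∈ s, fourierCoeff ψ k • fourier k with hS
  have h1 : ApproxBound (commProj (circOp S)) (∑ k ∈ s, (2 * k.natAbs + 1) + 1) 0 := by
    rw [hS, circOp_sum, commProj_sum]
    refine approxBound_sum s fun k _ => ?_
    rw [circOp_smul, commProj_smul]
    have := (approxBound_commProj_fourier k).comp_left
      (fourierCoeff ψ k • ContinuousLinearMap.id ℂ L2R)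
    rw [mul_zero] at this
    exact this
  have h2 := approxBound_norm (commProj (circOp (ψ - S))) (le_refl 1)
  have h3 : commProj (circOp ψ) = commProj (circOp S) + commProj (circOp (ψ - S)) := by
    rw [← commProj_add, ← circOp_add, add_sub_cancel]
  rw [h3]
  refine (h1.add h2).mono ?_ ?_
  · have h4 : ∑ k ∈ s, (2 * k.natAbs + 1) ≤ s.card * (2 * n) := by
      refine Finset.sum_le_card_nsmul _ _ _ fun k hk => ?_
      rw [hs, Finset.mem_Ioo] at hk
      omega
    have h5 : s.card ≤ 2 * n := by
      rw [hs, Int.card_Ioo]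
      omega
    have h6 := h4.trans (Nat.mul_le_mul_right (2 * n) h5)
    nlinarith
  · rw [zero_add]
    refine (norm_commProj_le _).trans ?_
    calc 2 * ‖circOp (ψ - S)‖ ≤ 2 * (C / (n : ℝ) ^ M) := by
          gcongr
          exact (norm_circOp_le _).trans (hC n hn)
      _ = 2 * C / (n : ℝ) ^ M := by ring
      _ ≤ _ := by
          gcongr
          push_cast
          linarith

end Circle

section FourierDecay

theorem integral_exp_mul_deriv {f : ℝ → ℂ} (hf : ContDiff ℝ ((⊤ : ℕ∞) : WithTop ℕ∞) f)
    (hper : Function.Periodic f Real.pi) (k : ℤ) :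
    ∫ x in (0 : ℝ)..Real.pi, Complex.exp (-(2 * Complex.I * k * x)) * deriv f x =
      2 * Complex.I * k * ∫ x in (0 : ℝ)..Real.pi, Complex.exp (-(2 * Complex.I * k * x)) * f x := by
  have hd : ∀ x : ℝ, HasDerivAt (fun x : ℝ => Complex.exp (-(2 * Complex.I * k * x)) * f x)
      (Complex.exp (-(2 * Complex.I * k * x)) * deriv f x -
        2 * Complex.I * k * (Complex.exp (-(2 * Complex.I * k * x)) * f x)) x := by
    intro x
    have h1 : HasDerivAt (fun x : ℝ => -(2 * Complex.I * k * (x : ℂ))) (-(2 * Complex.I * k)) x := by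
      have := (Complex.ofRealCLM.hasDerivAt (x := x)).const_mul (-(2 * Complex.I * k))
      simpa only [neg_mul, Complex.ofRealCLM_apply, Complex.ofReal_one, mul_one] using this
    have h2 : HasDerivAt f (deriv f x) x := (hf.differentiable (by simp) x).hasDerivAt
    refine (h1.cexp.mul h2).congr_deriv ?_
    ring
  have hcf : Continuous f := hf.continuous
  have hcf' : Continuous (deriv f) := hf.continuous_deriv (by simp)
  have hi : ∀ g : ℝ → ℂ, Continuous g → IntervalIntegrable
      (fun x : ℝ => Complex.exp (-(2 * Complex.I * k * x)) * g x) volume 0 Real.pi := fun g hg =>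
    Continuous.intervalIntegrable (by fun_prop) _ _
  have h1 := intervalIntegral.integral_eq_sub_of_hasDerivAt (fun x _ => hd x)
    ((hi _ hcf').sub ((hi _ hcf).const_mul (2 * Complex.I * k)))
  have h2 : f Real.pi = f 0 := by simpa using hper 0
  have h3 : Complex.exp (-(2 * Complex.I * k * Real.pi)) = 1 := by
    rw [Complex.exp_eq_one_iff]
    exact ⟨-k, by push_cast; ring⟩
  rw [intervalIntegral.integral_sub (hi _ hcf') ((hi _ hcf).const_mul _),
    intervalIntegral.integral_const_mul, h2, h3] at h1
  simpa [sub_eq_zero] using h1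

theorem exists_norm_integral_exp_mul_le (M : ℕ) : ∀ f : ℝ → ℂ,
    ContDiff ℝ ((⊤ : ℕ∞) : WithTop ℕ∞) f → Function.Periodic f Real.pi →
    ∃ C : ℝ, 0 ≤ C ∧ ∀ k : ℤ, k ≠ 0 →
      ‖∫ x in (0 : ℝ)..Real.pi, Complex.exp (-(2 * Complex.I * k * x)) * f x‖ ≤
        C / |(k : ℝ)| ^ M := by
  induction M with
  | zero =>
    intro f hf _
    obtain ⟨C, hC⟩ := isCompact_Icc.exists_bound_of_continuousOn (s := Icc 0 Real.pi)
      hf.continuous.continuousOn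
    have hC0 : 0 ≤ C := (norm_nonneg _).trans (hC 0 ⟨le_rfl, Real.pi_pos.le⟩)
    refine ⟨C * |Real.pi - 0|, by positivity, fun k _ => ?_⟩
    rw [pow_zero, div_one]
    refine intervalIntegral.norm_integral_le_of_norm_le_const fun x hx => ?_
    rw [uIoc_of_le Real.pi_pos.le] at hx
    rw [norm_mul, Complex.norm_exp]
    simpa using hC x ⟨hx.1.le, hx.2⟩
  | succ M ih =>
    intro f hf hper
    have hf' : ContDiff ℝ ((⊤ : ℕ∞) : WithTop ℕ∞) (deriv f) :=
      ((contDiff_infty_iff_deriv).1 hf).2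
    have hper' : Function.Periodic (deriv f) Real.pi := fun x => by
      rw [← deriv_comp_add_const]
      congr 1
      exact funext hper
    obtain ⟨C, hC0, hC⟩ := ih (deriv f) hf' hper'
    refine ⟨C, hC0, fun k hk => ?_⟩
    have h1 := hC k hk
    rw [integral_exp_mul_deriv hf hper, norm_mul] at h1
    have hk0 : 0 < |(k : ℝ)| := by positivity
    have h2 : ‖(2 * Complex.I * k : ℂ)‖ = 2 * |(k : ℝ)| := by simp
    rw [h2] at h1
    set J := ‖∫ x in (0 : ℝ)..Real.pi, Complex.exp (-(2 * Complex.I * k * x)) * f x‖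
    have hJ : 0 ≤ J := norm_nonneg _
    rw [le_div_iff₀ (by positivity)] at h1 ⊢
    rw [pow_succ]
    have : 0 ≤ J * (|(k : ℝ)| ^ M * |(k : ℝ)|) := by positivity
    nlinarith

theorem fourierCoeff_lift_eq {f : ℝ → ℂ} (ψ : C(AddCircle Real.pi, ℂ))
    (hψ : ∀ x : ℝ, ψ (x : AddCircle Real.pi) = f x) (k : ℤ) : fourierCoeff ψ k =
      (1 / Real.pi) * ∫ x in (0 : ℝ)..Real.pi, Complex.exp (-(2 * Complex.I * k * x)) * f x := by
  have hpi : (Real.pi : ℂ) ≠ 0 := by exact_mod_cast Real.pi_ne_zero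
  rw [fourierCoeff_eq_intervalIntegral _ _ 0, zero_add]
  have : ∀ x : ℝ, fourier (-k) (x : AddCircle Real.pi) • ψ (x : AddCircle Real.pi) =
      Complex.exp (-(2 * Complex.I * k * x)) * f x := fun x => by
    rw [hψ, fourier_coe_apply, smul_eq_mul]
    congr 2
    field_simp
    push_cast
    ring
  simp only [this]
  rw [Complex.real_smul]
  push_cast
  rfl

theorem exists_norm_fourierCoeff_le {f : ℝ → ℂ} (hf : ContDiff ℝ ((⊤ : ℕ∞) : WithTop ℕ∞) f)
    (hper : Function.Periodic f Real.pi) (ψ : C(AddCircle Real.pi, ℂ))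
    (hψ : ∀ x : ℝ, ψ (x : AddCircle Real.pi) = f x) (M : ℕ) :
    ∃ C : ℝ, 0 ≤ C ∧ ∀ k : ℤ, k ≠ 0 → ‖fourierCoeff ψ k‖ ≤ C / |(k : ℝ)| ^ M := by
  obtain ⟨C, hC0, hC⟩ := exists_norm_integral_exp_mul_le M f hf hper
  refine ⟨1 / Real.pi * C, by positivity, fun k hk => ?_⟩
  rw [fourierCoeff_lift_eq ψ hψ, norm_mul, mul_div_assoc]
  have : ‖(1 / Real.pi : ℂ)‖ = 1 / Real.pi := by
    rw [← Complex.ofReal_one, ← Complex.ofReal_div, Complex.norm_real, Real.norm_of_nonneg]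
    positivity
  rw [this]
  gcongr
  exact hC k hk

end FourierDecay

section SmoothFunctions

/-- A smooth function on the closed curve `ℝ_*`. -/
structure SmoothRStar (φ : RStar → ℂ) : Prop where
  contDiff_coe : ContDiff ℝ ((⊤ : ℕ∞) : WithTop ℕ∞) fun x : ℝ => φ x
  contDiff_chart : ContDiff ℝ ((⊤ : ℕ∞) : WithTop ℕ∞) fun y : ℝ => φ (chartInfty y)

/-- The parametrization of `ℝ_*` by the angle, inverse to `arctan`. -/
def angleMap (s : ℝ) : RStar := if Real.cos s = 0 then OnePoint.infty else ((Real.tan s : ℝ) : RStar)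

theorem angleMap_arctan (x : ℝ) : angleMap (Real.arctan x) = x := by
  rw [angleMap, if_neg (Real.cos_arctan_pos x).ne', Real.tan_arctan]

theorem angleMap_periodic : Function.Periodic angleMap Real.pi := fun s => by
  simp [angleMap, Real.cos_add_pi, Real.tan_periodic s]

theorem angleMap_eq_chart {s : ℝ} (hs : Real.sin s ≠ 0) :
    angleMap s = chartInfty (Real.cos s / Real.sin s) := by
  unfold angleMap chartInfty
  by_cases hc : Real.cos s = 0
  · simp [hc]
  · rw [if_neg hc, if_neg (div_ne_zero hc hs), inv_div, Real.tan_eq_sin_div_cos]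

theorem SmoothRStar.contDiff_angle {φ : RStar → ℂ} (hφ : SmoothRStar φ) :
    ContDiff ℝ ((⊤ : ℕ∞) : WithTop ℕ∞) fun s => φ (angleMap s) := by
  rw [contDiff_iff_contDiffAt]
  intro s
  by_cases hc : Real.cos s = 0
  · have hs : Real.sin s ≠ 0 := by
      intro h
      have := Real.sin_sq_add_cos_sq s
      rw [hc, h] at this
      norm_num at this
    have h1 : ContDiffAt ℝ ((⊤ : ℕ∞) : WithTop ℕ∞)
        (fun s => φ (chartInfty (Real.cos s / Real.sin s))) s :=
      hφ.contDiff_chart.contDiffAt.comp s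
        (Real.contDiff_cos.contDiffAt.div Real.contDiff_sin.contDiffAt hs)
    refine h1.congr_of_eventuallyEq ?_
    filter_upwards [Real.continuous_sin.continuousAt.eventually_ne hs] with t ht
    rw [angleMap_eq_chart ht]
  · have h1 : ContDiffAt ℝ ((⊤ : ℕ∞) : WithTop ℕ∞) (fun s => φ (Real.tan s : ℝ)) s :=
      hφ.contDiff_coe.contDiffAt.comp s (Real.contDiffAt_tan.2 hc)
    refine h1.congr_of_eventuallyEq ?_
    filter_upwards [Real.continuous_cos.continuousAt.eventually_ne hc] with t ht
    rw [angleMap, if_neg ht]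

theorem SmoothRStar.exists_circle {φ : RStar → ℂ} (hφ : SmoothRStar φ) :
    ∃ ψ : C(AddCircle Real.pi, ℂ), ∀ s : ℝ, ψ (s : AddCircle Real.pi) = φ (angleMap s) := by
  have hper : Function.Periodic (fun s => φ (angleMap s)) Real.pi := angleMap_periodic.comp φ
  refine ⟨⟨hper.lift, ?_⟩, fun s => hper.lift_coe s⟩
  exact continuous_coinduced_dom.2 hφ.contDiff_angle.continuous

theorem SmoothRStar.exists_bound {φ : RStar → ℂ} (hφ : SmoothRStar φ) :
    ∃ C : ℝ, ∀ x : ℝ, ‖φ x‖ ≤ C := by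
  obtain ⟨ψ, hψ⟩ := hφ.exists_circle
  refine ⟨‖ψ‖, fun x => ?_⟩
  rw [← angleMap_arctan x, ← hψ]
  exact ψ.norm_coe_le_norm _

theorem SmoothRStar.negligible_commProj {φ : RStar → ℂ} (hφ : SmoothRStar φ) {a : LinftyR}
    (ha : ∀ᵐ x : ℝ, a x = φ x) : Negligible (commProj (mulOp a)) := by
  obtain ⟨ψ, hψ⟩ := hφ.exists_circle
  have h : mulOp a = circOp ψ := by
    refine ContinuousLinearMap.ext fun f => Lp.ext ?_
    filter_upwards [mulOp_coeFn a f, circOp_coeFn ψ f, ha] with x h1 h2 h3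
    rw [h1, h2, h3, hψ, angleMap_arctan]
  rw [h]
  exact HankelLoc.negligible_commProj
    (exists_norm_fourierCoeff_le hφ.contDiff_angle (angleMap_periodic.comp φ) ψ hψ)

end SmoothFunctions

section SingularSupport

theorem continuous_chartInfty : Continuous chartInfty := by
  rw [continuous_iff_continuousAt]
  intro y
  by_cases hy : y = 0
  · subst hy
    have h0 : chartInfty 0 = OnePoint.infty := by simp [chartInfty]
    rw [continuousAt_iff_punctured_nhds, h0]
    have h1 : Tendsto (fun y : ℝ => ((y⁻¹ : ℝ) : RStar)) (nhdsWithin 0 {0}ᶜ)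
        (nhds OnePoint.infty) := by
      refine (OnePoint.tendsto_coe_infty (X := ℝ)).comp ?_
      rw [coclosedCompact_eq_cocompact, ← Metric.cobounded_eq_cocompact]
      exact tendsto_inv₀_nhdsNE_zero
    refine h1.congr' ?_
    filter_upwards [self_mem_nhdsWithin] with y hy
    rw [chartInfty, if_neg (show y ≠ 0 from hy)]
  · have h1 : ContinuousAt (fun y : ℝ => ((y⁻¹ : ℝ) : RStar)) y :=
      OnePoint.continuous_coe.continuousAt.comp (continuousAt_inv₀ hy)
    refine h1.congr ?_
    filter_upwards [isOpen_ne.mem_nhds hy] with z hz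
    rw [chartInfty, if_neg hz]

theorem isClosed_singSupp (ω : LinftyR) : IsClosed (singSupp ω) :=
  isClosed_sInter fun _ h => h.1

/-- Two smooth representatives of the same symbol agree on the common domain. -/
theorem eq_of_isSmooth_reps {ω : LinftyR} {U V : Set RStar} (hU : IsOpen U) (hV : IsOpen V)
    {f g : RStar → ℂ} (hf : ∀ᵐ x : ℝ, (x : RStar) ∈ U → ω x = f x)
    (hg : ∀ᵐ x : ℝ, (x : RStar) ∈ V → ω x = g x)
    (hfc : ContinuousOn (fun x : ℝ => f x) {x : ℝ | (x : RStar) ∈ U})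
    (hgc : ContinuousOn (fun x : ℝ => g x) {x : ℝ | (x : RStar) ∈ V})
    (hfy : ContinuousOn (fun y : ℝ => f (chartInfty y)) {y : ℝ | chartInfty y ∈ U})
    (hgy : ContinuousOn (fun y : ℝ => g (chartInfty y)) {y : ℝ | chartInfty y ∈ V})
    {p : RStar} (hpU : p ∈ U) (hpV : p ∈ V) : f p = g p := by
  have hW : IsOpen (U ∩ V) := hU.inter hV
  have hreal : ∀ x : ℝ, (x : RStar) ∈ U ∩ V → f x = g x := by
    have hWo : IsOpen {x : ℝ | (x : RStar) ∈ U ∩ V} := hW.preimage OnePoint.continuous_coe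
    have h1 : (fun x : ℝ => f x) =ᵐ[volume.restrict {x : ℝ | (x : RStar) ∈ U ∩ V}]
        fun x : ℝ => g x := by
      rw [EventuallyEq, ae_restrict_iff' hWo.measurableSet]
      filter_upwards [hf, hg] with x h2 h3 h4
      rw [← h2 h4.1, h3 h4.2]
    intro x hx
    exact Measure.eqOn_open_of_ae_eq h1 hWo (hfc.mono fun x hx => hx.1)
      (hgc.mono fun x hx => hx.2) hx
  induction p using OnePoint.rec with
  | coe x => exact hreal x ⟨hpU, hpV⟩
  | infty =>
    have h0 : chartInfty 0 = OnePoint.infty := by simp [chartInfty]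
    have hWo : IsOpen {y : ℝ | chartInfty y ∈ U ∩ V} := hW.preimage continuous_chartInfty
    have h0W : (0 : ℝ) ∈ {y : ℝ | chartInfty y ∈ U ∩ V} := by
      rw [mem_ofPred_eq, h0]; exact ⟨hpU, hpV⟩
    have hft : Tendsto (fun y : ℝ => f (chartInfty y)) (nhdsWithin 0 {0}ᶜ) (nhds (f OnePoint.infty)) := by
      have := ((hfy.mono fun y hy => hy.1).continuousAt (hWo.mem_nhds h0W)).tendsto
      rw [h0] at this
      exact this.mono_left nhdsWithin_le_nhds
    have hgt : Tendsto (fun y : ℝ => g (chartInfty y)) (nhdsWithin 0 {0}ᶜ) (nhds (g OnePoint.infty)) := by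
      have := ((hgy.mono fun y hy => hy.2).continuousAt (hWo.mem_nhds h0W)).tendsto
      rw [h0] at this
      exact this.mono_left nhdsWithin_le_nhds
    refine tendsto_nhds_unique hft (hgt.congr' ?_)
    filter_upwards [self_mem_nhdsWithin, nhdsWithin_le_nhds (hWo.mem_nhds h0W)] with y hy hyW
    have hy' : chartInfty y = ((y⁻¹ : ℝ) : RStar) := by
      rw [chartInfty, if_neg (show y ≠ 0 from hy)]
    rw [hy'] at hyW
    rw [hy', hreal _ hyW]

theorem isSmoothOn_compl_singSupp (ω : LinftyR) : IsSmoothOn ω (singSupp ω)ᶜ := by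
  have hloc : ∀ p : RStar, ∃ (U : Set RStar) (f : RStar → ℂ), p ∉ singSupp ω → IsOpen U ∧ p ∈ U ∧
      (∀ᵐ x : ℝ, (x : RStar) ∈ U → ω x = f x) ∧
      ContDiffOn ℝ ((⊤ : ℕ∞) : WithTop ℕ∞) (fun x : ℝ => f x) {x : ℝ | (x : RStar) ∈ U} ∧
      ContDiffOn ℝ ((⊤ : ℕ∞) : WithTop ℕ∞) (fun y : ℝ => f (chartInfty y))
        {y : ℝ | chartInfty y ∈ U} := by
    intro p
    by_cases hp : p ∈ singSupp ω
    · exact ⟨∅, 0, fun h => absurd hp h⟩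
    · rw [singSupp, mem_sInter] at hp
      push Not at hp
      obtain ⟨X, ⟨hX, f, hf⟩, hpX⟩ := hp
      exact ⟨Xᶜ, f, fun _ => ⟨hX.isOpen_compl, hpX, hf⟩⟩
  choose U f hUf using hloc
  have hag : ∀ p ∉ singSupp ω, ∀ q ∉ singSupp ω, q ∈ U p → f q q = f p q := by
    intro p hp q hq hqp
    obtain ⟨o1, -, a1, b1, c1⟩ := hUf p hp
    obtain ⟨o2, m2, a2, b2, c2⟩ := hUf q hq
    exact eq_of_isSmooth_reps o2 o1 a2 a1 b2.continuousOn b1.continuousOn c2.continuousOn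
      c1.continuousOn m2 hqp
  have hSo : IsOpen (singSupp ω)ᶜ := (isClosed_singSupp ω).isOpen_compl
  refine ⟨fun p => f p p, ?_, ?_, ?_⟩
  · rw [ae_iff]
    refine measure_null_of_locally_null _ fun x hx => ?_
    simp only [Classical.not_imp, mem_ofPred_eq] at hx
    obtain ⟨o1, m1, a1, -, -⟩ := hUf x hx.1
    refine ⟨_, inter_mem_nhdsWithin _
      ((o1.preimage OnePoint.continuous_coe).mem_nhds m1), ?_⟩
    rw [ae_iff] at a1
    refine measure_mono_null ?_ a1
    rintro z ⟨hz1, hz2⟩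
    simp only [Classical.not_imp, mem_ofPred_eq] at hz1 ⊢
    exact ⟨hz2, fun h => hz1.2 (h.trans (hag _ hx.1 _ hz1.1 hz2).symm)⟩
  · intro x hx
    obtain ⟨o1, m1, -, b1, -⟩ := hUf x hx
    have hn : {z : ℝ | (z : RStar) ∈ U x} ∈ nhds x :=
      (o1.preimage OnePoint.continuous_coe).mem_nhds m1
    refine ((b1.contDiffAt hn).congr_of_eventuallyEq ?_).contDiffWithinAt
    filter_upwards [hn, (hSo.preimage OnePoint.continuous_coe).mem_nhds hx] with z hz hz'
    exact hag _ hx _ hz' hz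
  · intro y hy
    obtain ⟨o1, m1, -, -, c1⟩ := hUf _ hy
    have hn : {z : ℝ | chartInfty z ∈ U (chartInfty y)} ∈ nhds y :=
      (o1.preimage continuous_chartInfty).mem_nhds m1
    refine ((c1.contDiffAt hn).congr_of_eventuallyEq ?_).contDiffWithinAt
    filter_upwards [hn, (hSo.preimage continuous_chartInfty).mem_nhds hy] with z hz hz'
    exact hag _ hy _ hz' hz

theorem IsSmoothOn.add {ω₁ ω₂ : LinftyR} {U V : Set RStar} (h₁ : IsSmoothOn ω₁ U)
    (h₂ : IsSmoothOn ω₂ V) : IsSmoothOn (ω₁ + ω₂) (U ∩ V) := by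
  obtain ⟨f, a1, b1, c1⟩ := h₁
  obtain ⟨g, a2, b2, c2⟩ := h₂
  refine ⟨fun p => f p + g p, ?_, ?_, ?_⟩
  · filter_upwards [a1, a2, Lp.coeFn_add ω₁ ω₂] with x h1 h2 h3 hx
    rw [h3, Pi.add_apply, h1 hx.1, h2 hx.2]
  · exact (b1.mono fun x hx => hx.1).add (b2.mono fun x hx => hx.2)
  · exact (c1.mono fun x hx => hx.1).add (c2.mono fun x hx => hx.2)

theorem singSupp_add_subset (ω₁ ω₂ : LinftyR) :
    singSupp (ω₁ + ω₂) ⊆ singSupp ω₁ ∪ singSupp ω₂ := by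
  refine sInter_subset_of_mem ⟨(isClosed_singSupp _).union (isClosed_singSupp _), ?_⟩
  rw [compl_union]
  exact (isSmoothOn_compl_singSupp ω₁).add (isSmoothOn_compl_singSupp ω₂)

theorem singSupp_zero : singSupp 0 = ∅ := by
  refine subset_empty_iff.1 (sInter_subset_of_mem ⟨isClosed_empty, fun _ => 0, ?_, ?_, ?_⟩)
  · filter_upwards [Lp.coeFn_zero ℂ ∞ (volume : Measure ℝ)] with x hx _
    exact hx
  · exact contDiffOn_const
  · exact contDiffOn_const

theorem singSupp_sum_subset {ι : Type*} (s : Finset ι) (ω : ι → LinftyR) :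
    singSupp (∑ i ∈ s, ω i) ⊆ ⋃ i ∈ s, singSupp (ω i) := by
  classical
  induction s using Finset.induction_on with
  | empty => simp [singSupp_zero]
  | insert a s ha ih =>
    rw [Finset.sum_insert ha, Finset.set_biUnion_insert]
    exact (singSupp_add_subset _ _).trans (union_subset_union_right _ ih)

end SingularSupport

section Cutoff

/-- The function `1 / (1 - i x)`, extended by `0` to `∞`. -/
def resolventRStar (p : RStar) : ℂ := p.elim 0 resolventFun

theorem resolventRStar_chart (y : ℝ) : resolventRStar (chartInfty y) = y / (y - Complex.I) := by
  by_cases hy : y = 0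
  · simp [chartInfty, hy, resolventRStar]
  · have hy' : (y : ℂ) ≠ 0 := by exact_mod_cast hy
    have h1 := one_sub_I_mul_ne_zero y⁻¹
    rw [chartInfty, if_neg hy]
    change resolventFun y⁻¹ = _
    rw [resolventFun]
    push_cast at h1 ⊢
    have h2 : (1 : ℂ) - Complex.I * (y : ℂ)⁻¹ = (y - Complex.I) / y := by field_simp
    rw [h2, inv_div]

theorem continuous_resolventRStar : Continuous resolventRStar := by
  rw [continuous_iff_continuousAt]
  intro p
  induction p using OnePoint.rec with
  | coe x => exact OnePoint.continuousAt_coe.2 continuous_resolventFun.continuousAt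
  | infty =>
    refine OnePoint.continuousAt_infty'.2 ?_
    rw [coclosedCompact_eq_cocompact, ← Metric.cobounded_eq_cocompact]
    have h : Tendsto (fun x : ℝ => (1 : ℂ) - Complex.I * x) (Bornology.cobounded ℝ)
        (Bornology.cobounded ℂ) := by
      rw [← tendsto_norm_atTop_iff_cobounded]
      refine tendsto_atTop_mono (fun x => ?_) (tendsto_norm_cobounded_atTop (E := ℝ))
      calc ‖x‖ = |((1 : ℂ) - Complex.I * x).im| := by simp
        _ ≤ _ := Complex.abs_im_le_norm _
    exact tendsto_inv₀_cobounded.comp h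

theorem injective_resolventRStar : Function.Injective resolventRStar := by
  intro p q h
  induction p using OnePoint.rec with
  | coe x =>
    induction q using OnePoint.rec with
    | coe y =>
      have h1 : (1 - Complex.I * x : ℂ)⁻¹ = (1 - Complex.I * y)⁻¹ := h
      have h2 := inv_injective h1
      simpa using h2
    | infty => exact absurd h (inv_ne_zero (one_sub_I_mul_ne_zero x))
  | infty =>
    induction q using OnePoint.rec with
    | coe y => exact absurd h.symm (inv_ne_zero (one_sub_I_mul_ne_zero y))
    | infty => rfl

theorem ofReal_sub_I_ne_zero (y : ℝ) : (y : ℂ) - Complex.I ≠ 0 := by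
  intro h
  have := congrArg Complex.im h
  simp at this

theorem smoothRStar_comp {g : ℂ → ℝ} (hg : ContDiff ℝ ((⊤ : ℕ∞) : WithTop ℕ∞) g) :
    SmoothRStar fun p => (g (resolventRStar p) : ℂ) := by
  have hof : ContDiff ℝ ((⊤ : ℕ∞) : WithTop ℕ∞) (fun x : ℝ => (x : ℂ)) :=
    Complex.ofRealCLM.contDiff
  constructor
  · refine hof.comp (hg.comp ?_)
    change ContDiff ℝ ((⊤ : ℕ∞) : WithTop ℕ∞) fun x : ℝ => (1 - Complex.I * (x : ℂ))⁻¹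
    exact (contDiff_const.sub (contDiff_const.mul hof)).inv one_sub_I_mul_ne_zero
  · simp only [resolventRStar_chart, div_eq_mul_inv]
    exact hof.comp (hg.comp (hof.mul ((hof.sub contDiff_const).inv ofReal_sub_I_ne_zero)))

open scoped Manifold in
theorem exists_smooth_cutoffs {X Y : Set RStar} (hX : IsClosed X) (hY : IsClosed Y)
    (hXY : Disjoint X Y) : ∃ χ η : RStar → ℂ, SmoothRStar χ ∧ SmoothRStar η ∧
      (∀ᶠ p in nhdsSet X, χ p = 1) ∧ (∀ᶠ p in nhdsSet Y, η p = 1) ∧ ∀ p, χ p * η p = 0 := by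
  have hK := hX.isCompact.image continuous_resolventRStar
  have hL := hY.isCompact.image continuous_resolventRStar
  have hKL : Disjoint (resolventRStar '' X) (resolventRStar '' Y) :=
    (disjoint_image_iff injective_resolventRStar).2 hXY
  obtain ⟨U, V, hU, hV, hKU, hLV, hUV⟩ := SeparatedNhds.of_isCompact_isCompact hK hL hKL
  have key : ∀ {X : Set RStar} {U : Set ℂ}, IsCompact (resolventRStar '' X) → IsOpen U →
      resolventRStar '' X ⊆ U → ∃ χ : RStar → ℂ, SmoothRStar χ ∧ (∀ᶠ p in nhdsSet X, χ p = 1) ∧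
        ∀ p, resolventRStar p ∉ U → χ p = 0 := by
    intro X U hK hU hKU
    obtain ⟨g, hg1, hg2, -⟩ := exists_contMDiffMap_one_nhds_of_subset_interior (n := ⊤)
      𝓘(ℝ, ℂ) hK.isClosed (hKU.trans hU.interior_eq.ge)
    refine ⟨fun p => (g (resolventRStar p) : ℂ), smoothRStar_comp g.contMDiff.contDiff, ?_, ?_⟩
    · filter_upwards [(continuous_resolventRStar.tendsto_nhdsSet (mapsTo_image _ X)).eventually
        hg1] with p hp
      simp [hp]
    · intro p hp
      simp [hg2 _ hp]
  obtain ⟨χ, h1, h2, h3⟩ := key hK hU hKU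
  obtain ⟨η, h4, h5, h6⟩ := key hL hV hLV
  refine ⟨χ, η, h1, h4, h2, h5, fun p => ?_⟩
  by_cases hp : resolventRStar p ∈ U
  · rw [h6 p (disjoint_left.1 hUV hp), mul_zero]
  · rw [h3 p hp, zero_mul]

/-- Cutting off the singular support leaves a smooth function. -/
theorem exists_smooth_one_sub_mul {ω : LinftyR} {χ : RStar → ℂ} (hχ : SmoothRStar χ)
    (h1 : ∀ᶠ p in nhdsSet (singSupp ω), χ p = 1) :
    ∃ φ : RStar → ℂ, SmoothRStar φ ∧ ∀ᵐ x : ℝ, ω x - χ x * ω x = φ x := by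
  obtain ⟨f, a, b, c⟩ := isSmoothOn_compl_singSupp ω
  have hSo : IsOpen (singSupp ω)ᶜ := (isClosed_singSupp ω).isOpen_compl
  have hnear : ∀ p ∈ singSupp ω, ∀ᶠ q in nhds p, χ q = 1 := fun p hp =>
    h1.filter_mono (nhds_le_nhdsSet hp)
  refine ⟨fun p => (1 - χ p) * f p, ⟨?_, ?_⟩, ?_⟩
  · rw [contDiff_iff_contDiffAt]
    intro x
    by_cases hx : (x : RStar) ∈ singSupp ω
    · refine (contDiffAt_const (c := (0 : ℂ))).congr_of_eventuallyEq ?_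
      filter_upwards [OnePoint.continuous_coe.continuousAt.eventually (hnear _ hx)] with z hz
      rw [hz, sub_self, zero_mul]
    · exact (contDiffAt_const.sub hχ.contDiff_coe.contDiffAt).mul
        (b.contDiffAt ((hSo.preimage OnePoint.continuous_coe).mem_nhds hx))
  · rw [contDiff_iff_contDiffAt]
    intro y
    by_cases hy : chartInfty y ∈ singSupp ω
    · refine (contDiffAt_const (c := (0 : ℂ))).congr_of_eventuallyEq ?_
      filter_upwards [continuous_chartInfty.continuousAt.eventually (hnear _ hy)] with z hz
      rw [hz, sub_self, zero_mul]
    · exact (contDiffAt_const.sub hχ.contDiff_chart.contDiffAt).mul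
        (c.contDiffAt ((hSo.preimage continuous_chartInfty).mem_nhds hy))
  · filter_upwards [a] with x hx
    by_cases hxs : (x : RStar) ∈ singSupp ω
    · rw [(hnear _ hxs).self_of_nhds]
      ring
    · rw [hx hxs]
      ring

end Cutoff

section Hankel

theorem hankel_add (a b : LinftyR) : hankel (a + b) = hankel a + hankel b := by
  simp [hankel, mulOp_add, ContinuousLinearMap.add_comp, ContinuousLinearMap.comp_add]

theorem adjoint_hankel (a : LinftyR) : (hankel a).adjoint =
    hardy.orthogonalProjectionOnto ∘L reflection ∘L mulOp (star a) ∘L hardy.subtypeL := by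
  simp only [hankel, ContinuousLinearMap.adjoint_comp, adjoint_mulOp, adjoint_reflection,
    Submodule.adjoint_subtypeL, Submodule.adjoint_orthogonalProjectionOnto,
    ContinuousLinearMap.comp_assoc]

/-- A Hankel operator with a smooth symbol is negligible. -/
theorem negligible_hankel {a : LinftyR} (h : Negligible (commProj (mulOp a))) :
    Negligible (hankel a) := by
  have h1 : hankel a = hardy.orthogonalProjectionOnto ∘L commProj (mulOp a) ∘L
      (reflection ∘L hardy.subtypeL) := by
    refine ContinuousLinearMap.ext fun f => ?_
    have h2 : hardyProj (reflection f) = 0 := by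
      have := hardyProj_reflection_hardyProj (f : L2R)
      rwa [Submodule.starProjection_eq_self_iff.2 f.2] at this
    change hardy.orthogonalProjectionOnto (mulOp a (reflection f)) =
      hardy.orthogonalProjectionOnto (commProj (mulOp a) (reflection f))
    rw [commProj_apply, h2, map_zero, sub_zero]
    exact (Submodule.orthogonalProjectionOnto_mem_subspace_eq_self _).symm
  rw [h1]
  exact (h.comp_right _).comp_left _

theorem negligible_mulOp_hardyProj_mulOp {c d : LinftyR} (hcd : ∀ᵐ x, c x * d x = 0)
    (hd : Negligible (commProj (mulOp d))) : Negligible (mulOp c ∘L hardyProj ∘L mulOp d) := by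
  have h0 : mulOp c ∘L mulOp d = 0 := by
    refine ContinuousLinearMap.ext fun f => Lp.ext ?_
    filter_upwards [mulOp_coeFn c (mulOp d f), mulOp_coeFn d f, hcd,
      Lp.coeFn_zero ℂ 2 (volume : Measure ℝ)] with x h1 h2 h3 h4
    have e : (0 : L2R →L[ℂ] L2R) f = 0 := rfl
    rw [e, ContinuousLinearMap.comp_apply, h1, h2, ← mul_assoc, h3, zero_mul, h4]
    rfl
  have h1 : mulOp c ∘L hardyProj ∘L mulOp d = mulOp c ∘L commProj (mulOp d) := by
    refine ContinuousLinearMap.ext fun f => ?_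
    have h2 : mulOp c (mulOp d (hardyProj f)) = 0 := congrArg (fun X => X (hardyProj f)) h0
    change mulOp c (hardyProj (mulOp d f)) = mulOp c (commProj (mulOp d) f)
    rw [commProj_apply, map_sub, h2, sub_zero]
  rw [h1]
  exact hd.comp_left _

theorem negligible_adjoint_hankel_comp_hankel {c d a b : LinftyR} (hcd : ∀ᵐ x, c x * d x = 0)
    (hd : Negligible (commProj (mulOp d))) :
    Negligible ((hankel (symbolMul c a)).adjoint ∘L hankel (symbolMul d b)) := by
  have hcd' : ∀ᵐ x, (star c : LinftyR) x * d x = 0 := by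
    filter_upwards [hcd, Lp.coeFn_star c] with x h1 h2
    rw [h2]
    rcases mul_eq_zero.1 h1 with h | h <;> simp [h]
  have h1 : (hankel (symbolMul c a)).adjoint ∘L hankel (symbolMul d b) =
      (hardy.orthogonalProjectionOnto ∘L reflection ∘L mulOp (star a)) ∘L
        (mulOp (star c) ∘L hardyProj ∘L mulOp d) ∘L
          (mulOp b ∘L reflection ∘L hardy.subtypeL) := by
    rw [adjoint_hankel, hankel, mulOp_symbolMul, ← adjoint_mulOp, mulOp_symbolMul,
      ContinuousLinearMap.adjoint_comp, adjoint_mulOp, adjoint_mulOp]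
    rfl
  rw [h1]
  exact ((negligible_mulOp_hardyProj_mulOp hcd' hd).comp_right _).comp_left _

theorem negligible_hankel_comp_adjoint_hankel {c d a b : LinftyR} (hcd : ∀ᵐ x, c x * d x = 0)
    (hd : Negligible (commProj (mulOp d))) :
    Negligible (hankel (symbolMul c a) ∘L (hankel (symbolMul d b)).adjoint) := by
  have hcd' : ∀ᵐ x, c x * (star d : LinftyR) x = 0 := by
    filter_upwards [hcd, Lp.coeFn_star d] with x h1 h2
    rw [h2]
    rcases mul_eq_zero.1 h1 with h | h <;> simp [h]
  have hd' : Negligible (commProj (mulOp (star d))) := by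
    rw [← adjoint_mulOp, commProj_adjoint]
    exact hd.adjoint.neg
  have h1 : hankel (symbolMul c a) ∘L (hankel (symbolMul d b)).adjoint =
      -((hardy.orthogonalProjectionOnto ∘L mulOp a) ∘L
        (mulOp c ∘L hardyProj ∘L mulOp (star d)) ∘L
          (mulOp (star b) ∘L hardy.subtypeL)) := by
    rw [adjoint_hankel, hankel, mulOp_symbolMul, mulOp_comm c a, ← adjoint_mulOp, mulOp_symbolMul,
      mulOp_comm d b, ContinuousLinearMap.adjoint_comp, adjoint_mulOp, adjoint_mulOp]
    refine ContinuousLinearMap.ext fun f => ?_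
    set v := mulOp (star d) (mulOp (star b) (f : L2R)) with hv
    have h0 : mulOp c v = 0 := by
      refine Lp.ext ?_
      filter_upwards [mulOp_coeFn c v, mulOp_coeFn (star d) (mulOp (star b) (f : L2R)), hcd',
        Lp.coeFn_zero ℂ 2 (volume : Measure ℝ)] with x h1 h2 h3 h4
      rw [h1, hv, h2, ← mul_assoc, h3, zero_mul, h4]
      rfl
    change hardy.orthogonalProjectionOnto (mulOp a (mulOp c (reflection (hardyProj
      (reflection v))))) = -hardy.orthogonalProjectionOnto (mulOp a (mulOp c (hardyProj v)))
    rw [reflection_hardyProj_reflection, map_sub, h0, zero_sub, map_neg, map_neg]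
  rw [h1]
  exact (((negligible_mulOp_hardyProj_mulOp hcd' hd').comp_right _).comp_left _).neg

/-- Localization: a symbol differs by a smooth function from its restriction to a neighbourhood of
the singular support. -/
theorem exists_hankel_eq_add_negligible {ω c : LinftyR} {χ : RStar → ℂ} (hχ : SmoothRStar χ)
    (h1 : ∀ᶠ p in nhdsSet (singSupp ω), χ p = 1) (hc : ∀ᵐ x : ℝ, c x = χ x) :
    ∃ K, Negligible K ∧ hankel ω = hankel (symbolMul c ω) + K := by
  obtain ⟨φ, hφ, hφω⟩ := exists_smooth_one_sub_mul hχ h1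
  refine ⟨hankel (ω - symbolMul c ω), negligible_hankel (hφ.negligible_commProj ?_), ?_⟩
  · filter_upwards [hφω, hc, symbolMul_coeFn c ω, Lp.coeFn_sub ω (symbolMul c ω)]
      with x h1 h2 h3 h4
    rw [h4, Pi.sub_apply, h3, h2, h1]
  · rw [← hankel_add, add_sub_cancel]

theorem SmoothRStar.exists_symbol {χ : RStar → ℂ} (hχ : SmoothRStar χ) :
    ∃ c : LinftyR, ∀ᵐ x : ℝ, c x = χ x := by
  obtain ⟨C, hC⟩ := hχ.exists_bound
  exact ⟨boundedSymbol (fun x : ℝ => χ x) hχ.contDiff_coe.continuous.measurable hC,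
    boundedSymbol_coeFn _ _⟩

theorem hankel_add_localization {ω₁ ω₂ : LinftyR} (h : Disjoint (singSupp ω₁) (singSupp ω₂))
    {q : ℝ} (hq : 0 < q) :
    upperLim q (hankel (ω₁ + ω₂)) ≤ upperLim q (hankel ω₁) + upperLim q (hankel ω₂) ∧
      lowerLim q (hankel ω₁) + lowerLim q (hankel ω₂) ≤ lowerLim q (hankel (ω₁ + ω₂)) := by
  obtain ⟨χ, η, hχ, hη, hχ1, hη1, hχη⟩ :=
    exists_smooth_cutoffs (isClosed_singSupp ω₁) (isClosed_singSupp ω₂) h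
  obtain ⟨c, hc⟩ := hχ.exists_symbol
  obtain ⟨d, hd⟩ := hη.exists_symbol
  obtain ⟨K, hK, hKeq⟩ := exists_hankel_eq_add_negligible hχ hχ1 hc
  obtain ⟨J, hJ, hJeq⟩ := exists_hankel_eq_add_negligible hη hη1 hd
  have hcd : ∀ᵐ x, c x * d x = 0 := by
    filter_upwards [hc, hd] with x h1 h2
    rw [h1, h2, hχη]
  have hdn := hη.negligible_commProj hd
  have hsum : hankel (ω₁ + ω₂) =
      (hankel (symbolMul c ω₁) + hankel (symbolMul d ω₂)) + (K + J) := by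
    rw [hankel_add, hKeq, hJeq]
    abel
  have o1 := negligible_adjoint_hankel_comp_hankel (a := ω₁) (b := ω₂) hcd hdn
  have o2 := negligible_hankel_comp_adjoint_hankel (a := ω₁) (b := ω₂) hcd hdn
  rw [hsum, hKeq, hJeq, upperLim_add_negligible hq _ (hK.add hJ),
    lowerLim_add_negligible hq _ (hK.add hJ), upperLim_add_negligible hq _ hK,
    upperLim_add_negligible hq _ hJ, lowerLim_add_negligible hq _ hK,
    lowerLim_add_negligible hq _ hJ]
  exact ⟨upperLim_add_le_of_orthogonal o1 o2 hq, le_lowerLim_add_of_orthogonal o1 o2 hq⟩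

theorem hankel_zero : hankel 0 = 0 := by
  have h := hankel_add 0 0
  rwa [add_zero, left_eq_add] at h

theorem upperLim_zero {q : ℝ} (hq : 0 < q) {E : Type*} [NormedAddCommGroup E]
    [InnerProductSpace ℂ E] : upperLim q (0 : E →L[ℂ] E) = 0 := by
  have h : weighted q (approxNumber (0 : E →L[ℂ] E)) =ᶠ[atTop] fun _ => 0 := by
    filter_upwards [eventually_ge_atTop 1] with n hn
    have h1 : approxNumber (0 : E →L[ℂ] E) n = 0 := by
      refine le_antisymm (approxNumber_le le_rfl ?_) (approxNumber_nonneg _ _)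
      simpa using approxBound_norm (0 : E →L[ℂ] E) hn
    rw [weighted, h1, ENNReal.ofReal_zero, ENNReal.zero_rpow_of_pos hq, mul_zero]
  rw [upperLim, limsup_congr h, limsup_const]

theorem hankel_sum_localization {ι : Type*} (s : Finset ι) (ω : ι → LinftyR)
    (hω : ∀ i ∈ s, ∀ j ∈ s, i ≠ j → singSupp (ω i) ∩ singSupp (ω j) = ∅)
    {q : ℝ} (hq : 0 < q) :
    upperLim q (hankel (∑ i ∈ s, ω i)) ≤ ∑ i ∈ s, upperLim q (hankel (ω i)) ∧
      ∑ i ∈ s, lowerLim q (hankel (ω i)) ≤ lowerLim q (hankel (∑ i ∈ s, ω i)) := by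
  classical
  induction s using Finset.induction_on with
  | empty => simp [hankel_zero, upperLim_zero hq]
  | insert a s ha ih =>
    have ih' := ih fun i hi j hj => hω i (Finset.mem_insert_of_mem hi) j
      (Finset.mem_insert_of_mem hj)
    have hdis : Disjoint (singSupp (ω a)) (singSupp (∑ i ∈ s, ω i)) := by
      refine Disjoint.mono_right (singSupp_sum_subset s ω) ?_
      rw [disjoint_iUnion₂_right]
      intro i hi
      rw [disjoint_iff_inter_eq_empty]
      exact hω a (Finset.mem_insert_self a s) i (Finset.mem_insert_of_mem hi)
        (fun h => ha (h ▸ hi))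
    obtain ⟨h1, h2⟩ := hankel_add_localization hdis hq
    rw [Finset.sum_insert ha, Finset.sum_insert ha, Finset.sum_insert ha]
    exact ⟨h1.trans (by gcongr; exact ih'.1), le_trans (by gcongr; exact ih'.2) h2⟩

end Hankel

end HankelLoc

end

theorem theorem2p5 (L : ℕ) (ω : Fin L → HankelLoc.LinftyR)
    (hω : ∀ ℓ j : Fin L, ℓ ≠ j →
      HankelLoc.singSupp (ω ℓ) ∩ HankelLoc.singSupp (ω j) = ∅)
    (p : ℝ) (hp : 0 < p) :
    limsup (fun n : ℕ => (n : ℝ≥0∞) *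
        ENNReal.ofReal (HankelLoc.singularValue (HankelLoc.hankel (∑ ℓ, ω ℓ)) n) ^ p) atTop
      ≤ ∑ ℓ, limsup (fun n : ℕ => (n : ℝ≥0∞) *
        ENNReal.ofReal (HankelLoc.singularValue (HankelLoc.hankel (ω ℓ)) n) ^ p) atTop ∧
    ∑ ℓ, liminf (fun n : ℕ => (n : ℝ≥0∞) *
        ENNReal.ofReal (HankelLoc.singularValue (HankelLoc.hankel (ω ℓ)) n) ^ p) atTop
      ≤ liminf (fun n : ℕ => (n : ℝ≥0∞) *
        ENNReal.ofReal (HankelLoc.singularValue (HankelLoc.hankel (∑ ℓ, ω ℓ)) n) ^ p) atTop := by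
  simp only [HankelLoc.singularValue_eq_approxNumber]
  exact HankelLoc.hankel_sum_localization Finset.univ ω (fun i _ j _ => hω i j) hp
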